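/- Let $P_1,\dots,P_N$ be discrete probability measures on $\mathbb R^d$ (finitely supported, total mass $1$), let $\lambda_1,\dots,\lambda_N>0$ with $\sum_i\lambda_i=1$, let $|P|$ denote the number of support points of $P$, and put $$\phi(P)=\sum_{i=1}^N\lambda_i W_2(P,P_i)^2,\qquad S=\Big\{\sum_{i=1}^N\lambda_i x_i : x_i\in\operatorname{supp}(P_i)\Big\},\qquad S_{\mathrm{org}}=\bigcup_{i=1}^N\operatorname{supp}(P_i).$$ A barycenter $\bar P$ is a minimizer of $\phi$ over all Borel probability measures on $\mathbb R^d$ with finite second moment. A transport from a discrete measure $P$ to $P_1,\dots,P_N$ is a family $y_i(x,k)\ge 0$ ($x\in\operatorname{supp}P$, $k\in\operatorname{supp}P_i$) with $\sum_k y_i(x,k)=P(x)$ and $\sum_x y_i(x,k)=P_i(k)$; its cost is $\sum_i\lambda_i\sum_{x,k}\|x-k\|^2y_i(x,k)$; it is non-mass splitting if for every $x\in\operatorname{supp}P$ and every $i$ there is a single $k$ with $y_i(x,k)=P(x)$ and $y_i(x,k')=0$ for $k'\ne k$. Consider the following algorithm (recovery of non-mass split). Its input is an optimal vertex $(z,y)$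 of the linear program that minimizes the cost over all pairs of a measure $z$ with $\operatorname{supp}z\subseteq S_{\mathrm{org}}$ and a transport $y$ from $z$ to $P_1,\dots,P_N$. 1. Enumerate $\operatorname{supp}(z)=\{s_1,\dots,s_r\}$ in any order, and let $d_l=z(s_l)$ and $P_i^l(k)=y_i(s_l,k)$. 2. For $l=r,\dots,1$ and, for each $l$, for $j=1,\dots,l-1$: as long as $d_l>0$, choose for each $i$ a point $q_i\in\operatorname{supp}(P_i^l)$ maximizing $(s_j-s_l)^Tx$ over $x\in\operatorname{supp}(P_i^l)$ (ties broken arbitrarily), and let $c=\sum_i\lambda_iq_i$. If $\|c-s_j\|^2\neq\|c-s_l\|^2$, go on to the next pair $(l,j)$. Otherwise let $m=\min_iP_i^l(q_i)$, decrease $d_l$ and all $P_i^l(q_i)$ by $m$, increase $d_j$ and all $P_i^j(q_i)$ by $m$, and repeat. 3. For $l=1,\dots,r$: start with $\bar P^l=0$; as long as $d_l>0$, let $q_i$ be the lexicographically maximal point of $\operatorname{supp}(P_i^l)$ for each $i$, let $c=\sum_i\lambda_iq_i$ and $m=\min_iP_i^l(q_i)$, decrease $d_l$ and all $P_i^l(q_i)$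 by $m$, and add mass $m$ at $c$ to $\bar P^l$. 4. Return $\bar P'=\sum_{l=1}^r\bar P^l$. Theorem. Every run of this algorithm terminates and returns a discrete probability measure $\bar P'$. Every returned $\bar P'$ satisfies $\operatorname{supp}(\bar P')\subseteq S$ and, for every barycenter $\bar P$, $\phi(\bar P')\le 2\,\phi(\bar P)$. There is a non-mass splitting transport (not necessarily optimal) from $\bar P'$ to $P_1,\dots,P_N$ whose cost is at most $2\,\phi(\bar P)$ for every barycenter $\bar P$. Moreover $$|\bar P'|\le\Big(\sum_{i=1}^N|P_i|-N+1\Big)^2.$$ -/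

import Mathlib

open MeasureTheory
open scoped ENNReal

noncomputable section

namespace WBary

/-- Euclidean space `ℝ^d`. -/
abbrev Pt (d : ℕ) := EuclideanSpace ℝ (Fin d)

/-- A finitely supported mass assignment on `ℝ^d` (masses at all other points are `0`);
`p.support` is the support and `p.support.card` its size. -/
abbrev Mass (d : ℕ) := Pt d →₀ ℝ

/-- A discrete probability measure: nonnegative masses of total `1`. -/
structure IsDiscreteProb {d : ℕ} (p : Mass d) : Prop where
  nonneg : ∀ x, 0 ≤ p x
  total : ∑ x ∈ p.support, p x = 1

/-- The Borel measure on `ℝ^d` with the given point masses. -/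
def toMeasure {d : ℕ} (p : Mass d) : Measure (Pt d) :=
  ∑ x ∈ p.support, ENNReal.ofReal (p x) • Measure.dirac x

/-! ### Wasserstein distance and barycenters -/

/-- Couplings of two measures. -/
def couplings {d : ℕ} (μ ν : Measure (Pt d)) : Set (Measure (Pt d × Pt d)) :=
  {π | π.map Prod.fst = μ ∧ π.map Prod.snd = ν}

/-- The quadratic Wasserstein distance. -/
def W2 {d : ℕ} (μ ν : Measure (Pt d)) : ℝ≥0∞ :=
  (⨅ π ∈ couplings μ ν, ∫⁻ q, ‖q.1 - q.2‖ₑ ^ 2 ∂π) ^ (1 / 2 : ℝ)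

/-- `φ(μ) = ∑ i, λ i * W₂(μ, P i)²`. -/
def phi {d N : ℕ} (lam : Fin N → ℝ) (P : Fin N → Mass d) (μ : Measure (Pt d)) : ℝ≥0∞ :=
  ∑ i, ENNReal.ofReal (lam i) * W2 μ (toMeasure (P i)) ^ 2

/-- Borel probability measures on `ℝ^d` with finite second moment. -/
def P2 (d : ℕ) : Set (Measure (Pt d)) :=
  {μ | IsProbabilityMeasure μ ∧ ∫⁻ x, ‖x‖ₑ ^ 2 ∂μ < ∞}

/-- A (`λ`-weighted) Wasserstein barycenter of `P 1, …, P N`: a minimizer of `φ` among all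
probability measures with finite second moment. -/
def IsBarycenter {d N : ℕ} (lam : Fin N → ℝ) (P : Fin N → Mass d) (μ : Measure (Pt d)) :
    Prop :=
  μ ∈ P2 d ∧ phi lam P μ = ⨅ ν ∈ P2 d, phi lam P ν

/-! ### Supports, transports, the linear program -/

/-- The set `S` of weighted centroids of one support point from each measure. -/
def centroidSet {d N : ℕ} (lam : Fin N → ℝ) (P : Fin N → Mass d) : Set (Pt d) :=
  {x | ∃ f : Fin N → Pt d, (∀ i, f i ∈ (P i).support) ∧ x = ∑ i, lam i • f i}

/-- The union of the supports of the measures. -/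
def origSupport {d N : ℕ} (P : Fin N → Mass d) : Set (Pt d) :=
  {x | ∃ i, x ∈ (P i).support}

/-- `y i x k` is the mass sent from the point `x` to the point `k` of the `i`-th measure. -/
abbrev Plan (d N : ℕ) := Fin N → Pt d → Mass d

/-- `y` is a transport from `p` to `P 1, …, P N`. -/
structure IsTransport {d N : ℕ} (P : Fin N → Mass d) (p : Mass d) (y : Plan d N) : Prop where
  nonneg : ∀ i x k, 0 ≤ y i x k
  supp : ∀ i x k, y i x k ≠ 0 → x ∈ p.support ∧ k ∈ (P i).support
  row : ∀ i, ∀ x, ∑ k ∈ (P i).support, y i x k = p x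
  col : ∀ i, ∀ k, ∑ x ∈ p.support, y i x k = P i k

/-- The cost `∑ i, λ i ∑ x ∑ k, ‖x - k‖² y i x k` of a transport. -/
def cost {d N : ℕ} (lam : Fin N → ℝ) (P : Fin N → Mass d) (p : Mass d) (y : Plan d N) : ℝ :=
  ∑ i, lam i * ∑ x ∈ p.support, ∑ k ∈ (P i).support, ‖x - k‖ ^ 2 * y i x k

/-- Every support point of `p` sends its whole mass to a single support point of each `P i`. -/
def NonMassSplitting {d N : ℕ} (P : Fin N → Mass d) (p : Mass d) (y : Plan d N) : Prop :=
  ∀ x ∈ p.support, ∀ i, ∃ k ∈ (P i).support, y i x k = p x ∧ ∀ k', k' ≠ k → y i x k' = 0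

/-- The feasible region of the linear program whose variables are a measure `z` supported in
`S₀` and a transport `y` from `z` to the `P i`. -/
def feasible {d N : ℕ} (P : Fin N → Mass d) (S₀ : Set (Pt d)) : Set (Mass d × Plan d N) :=
  {zy | (∀ x ∈ zy.1.support, x ∈ S₀) ∧ IsTransport P zy.1 zy.2}

/-- `zy = (z, y)` is an optimal vertex of the linear program over the possible support `S₀`. -/
def IsOptimalVertex {d N : ℕ} (lam : Fin N → ℝ) (P : Fin N → Mass d) (S₀ : Set (Pt d))
    (zy : Mass d × Plan d N) : Prop :=
  zy ∈ (feasible P S₀).extremePoints ℝ ∧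
    ∀ zy' ∈ feasible P S₀, cost lam P zy.1 zy.2 ≤ cost lam P zy'.1 zy'.2

/-! ### The algorithm "recovery of non-mass split"

The algorithm is a transition system. Ties in an `argmax` may be resolved arbitrarily, so a
configuration can have several successors. -/

/-- The variables of the algorithm, for `r` support points `s 1, …, s r`. Points of mass `0` are
automatically absent from the support of a `Mass`, which takes care of removing and re-adding
support points. -/
structure State (d N r : ℕ) where
  /-- `part l i` is the partial measure `P_i^l`. -/
  part : Fin r → Fin N → Mass d
  /-- the masses `d_l` -/
  mass : Fin r → ℝ
  /-- the partial measures built in the spreading phase -/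
  out : Fin r → Mass d

/-- The loop bodies: `shift l j` is the loop moving mass from `s l` to `s j`, and `spread l` is
the loop spreading `s l` out to weighted centroids. -/
inductive Instr (r : ℕ) where
  | shift (l j : Fin r)
  | spread (l : Fin r)

/-- The order in which the loops are executed: for `l` descending, for `j < l` ascending,
`shift l j`; afterwards, for `l` ascending, `spread l`. -/
def program (r : ℕ) : List (Instr r) :=
  ((List.finRange r).reverse.flatMap fun l =>
      ((List.finRange r).filter fun j => j < l).map fun j => Instr.shift l j) ++
    (List.finRange r).map fun l => Instr.spread l

/-- Loops still to be executed (the first one being the current one), and the variables. -/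
abbrev Config (d N r : ℕ) := List (Instr r) × State d N r

/-- The start: the parts of `z` are read off from the transport `y`. -/
def initial {d N r : ℕ} (z : Mass d) (y : Plan d N) (s : Fin r → Pt d) : Config d N r :=
  (program r, { part := fun l i => y i (s l), mass := fun l => z (s l), out := fun _ => 0 })

/-- The weighted centroid of the points `q i`. -/
def centroid {d N : ℕ} (lam : Fin N → ℝ) (q : Fin N → Pt d) : Pt d := ∑ i, lam i • q i

/-- `q i` is a support point of `part l i` that is furthest in direction `s j - s l`. -/
def IsArgmaxChoice {d N r : ℕ} (s : Fin r → Pt d) (σ : State d N r) (l j : Fin r)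
    (q : Fin N → Pt d) : Prop :=
  ∀ i, q i ∈ (σ.part l i).support ∧
    ∀ x ∈ (σ.part l i).support, inner ℝ (s j - s l) x ≤ inner ℝ (s j - s l) (q i)

/-- `q i` is the lexicographically maximal support point of `part l i`. -/
def IsLexMaxChoice {d N r : ℕ} (σ : State d N r) (l : Fin r) (q : Fin N → Pt d) : Prop :=
  ∀ i, q i ∈ (σ.part l i).support ∧
    ∀ x ∈ (σ.part l i).support, toLex (fun a : Fin d => x a) ≤ toLex (fun a : Fin d => q i a)

/-- `m` is the minimal mass of the points `q i` in the `part l i`. -/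
def IsMinMass {d N r : ℕ} (σ : State d N r) (l : Fin r) (q : Fin N → Pt d) (m : ℝ) : Prop :=
  IsLeast (Set.range fun i => σ.part l i (q i)) m

/-- Remove mass `m` from `s l` and from the points `q i` of the `part l i`. -/
def State.remove {d N r : ℕ} (σ : State d N r) (l : Fin r) (q : Fin N → Pt d) (m : ℝ) :
    State d N r :=
  { σ with
    part := Function.update σ.part l fun i => σ.part l i - Finsupp.single (q i) m
    mass := Function.update σ.mass l (σ.mass l - m) }

/-- Add mass `m` to `s j` and to the points `q i` of the `part j i`. -/
def State.insert {d N r : ℕ} (σ : State d N r) (j : Fin r) (q : Fin N → Pt d) (m : ℝ) :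
    State d N r :=
  { σ with
    part := Function.update σ.part j fun i => σ.part j i + Finsupp.single (q i) m
    mass := Function.update σ.mass j (σ.mass j + m) }

/-- Add the point `c` with mass `m` to the `l`-th output part. -/
def State.emit {d N r : ℕ} (σ : State d N r) (l : Fin r) (c : Pt d) (m : ℝ) : State d N r :=
  { σ with out := Function.update σ.out l (σ.out l + Finsupp.single c m) }

/-- One step of the algorithm. A loop for `l` is left as soon as no mass remains at `s l`. -/
inductive Step {d N r : ℕ} (lam : Fin N → ℝ) (s : Fin r → Pt d) :
    Config d N r → Config d N r → Prop
  /-- equidistant centroid: shift mass from `s l` to `s j` and repeat -/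
  | shift_move (l j : Fin r) (is : List (Instr r)) (σ : State d N r) (q : Fin N → Pt d) (m : ℝ)
      (hpos : 0 < σ.mass l) (hq : IsArgmaxChoice s σ l j q)
      (heq : ‖centroid lam q - s j‖ ^ 2 = ‖centroid lam q - s l‖ ^ 2)
      (hm : IsMinMass σ l q m) :
      Step lam s (Instr.shift l j :: is, σ)
        (Instr.shift l j :: is, (σ.remove l q m).insert j q m)
  /-- centroid not equidistant: go on with the next loop -/
  | shift_stop (l j : Fin r) (is : List (Instr r)) (σ : State d N r) (q : Fin N → Pt d)
      (hpos : 0 < σ.mass l) (hq : IsArgmaxChoice s σ l j q)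
      (hne : ‖centroid lam q - s j‖ ^ 2 ≠ ‖centroid lam q - s l‖ ^ 2) :
      Step lam s (Instr.shift l j :: is, σ) (is, σ)
  /-- no mass left at `s l`: go on with the next loop -/
  | shift_exit (l j : Fin r) (is : List (Instr r)) (σ : State d N r)
      (hpos : ¬ 0 < σ.mass l) :
      Step lam s (Instr.shift l j :: is, σ) (is, σ)
  /-- move mass from `s l` to the centroid of lexicographically maximal points and repeat -/
  | spread_move (l : Fin r) (is : List (Instr r)) (σ : State d N r) (q : Fin N → Pt d) (m : ℝ)
      (hpos : 0 < σ.mass l) (hq : IsLexMaxChoice σ l q) (hm : IsMinMass σ l q m) :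
      Step lam s (Instr.spread l :: is, σ)
        (Instr.spread l :: is, (σ.remove l q m).emit l (centroid lam q) m)
  /-- no mass left at `s l`: go on with the next loop -/
  | spread_exit (l : Fin r) (is : List (Instr r)) (σ : State d N r)
      (hpos : ¬ 0 < σ.mass l) :
      Step lam s (Instr.spread l :: is, σ) (is, σ)

/-- `c` is reached by some (partial) run started in `c₀`. -/
def Reaches {d N r : ℕ} (lam : Fin N → ℝ) (s : Fin r → Pt d) (c₀ c : Config d N r) : Prop :=
  Relation.ReflTransGen (Step lam s) c₀ c

/-- Every run started in `c₀` is finite and, unless it can be continued, has executed the whole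
program. -/
def AlwaysReturns {d N r : ℕ} (lam : Fin N → ℝ) (s : Fin r → Pt d) (c₀ : Config d N r) : Prop :=
  (¬ ∃ f : ℕ → Config d N r, f 0 = c₀ ∧ ∀ n, Step lam s (f n) (f (n + 1))) ∧
    ∀ c, Reaches lam s c₀ c → (∀ c', ¬ Step lam s c c') → c.1 = []

/-- Some complete run of the algorithm on input `(z, y)`, with the support points of `z`
enumerated as `s 1, …, s r`, returns `p`, the sum of the partial measures that were built. -/
def Returns {d N r : ℕ} (lam : Fin N → ℝ) (z : Mass d) (y : Plan d N) (s : Fin r → Pt d)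
    (p : Mass d) : Prop :=
  ∃ σ : State d N r, Reaches lam s (initial z y s) ([], σ) ∧ p = ∑ l, σ.out l

end WBary

end

/-!
The algorithm keeps a transport from masses at the points `s l` to the measures `P i`, split into
partial measures.

Termination. Every move exhausts a support point of one of the partial measures of the point that
is being processed (`step_invariant`), and as long as a mass is positive its partial measures are
nonempty, so that a further step is possible (`exists_step`).

No mass is split. By Huygens' identity, moving mass of a tuple `q` (one point of every `P i`) from
`s l` to `s j` changes the cost by the mass times the difference of the squared distances from the
centroid of `q` to `s j` and to `s l`. As the transport is optimal and shifting preserves the cost,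
all centroids fed from `s l` are at least as close to `s l` as to every `s j`
(`IsCheapest.sq_dist_centroid_le`). When the loop for `(l, j)` ends, they are even strictly closer,
since the tuple extreme in direction `s j - s l` is the critical one; later loops preserve this
because they only feed points of smaller index (`ShiftInv.step`). Hence different points feed
different centroids (`ShiftInv.centroid_ne`). The tuples spread from a single point decrease
lexicographically, so their centroids are distinct as well (`SpreadInvAt.move`). The output is
therefore the image, under a centroid map that is injective on its support, of a measure on tuples
with marginals `P i` (`exists_tuples_of_spreadInv`).

The bound `2`. Moving the mass of a tuple to its centroid does not increase the cost, so the cost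
of the transport found is at most the optimal value of the linear program. Given couplings of a
probability measure `μ` with all `P i`, glue them along `μ`, with conditionally independent
`X i ∼ P i` given `X ∼ μ`. The feasible points with `z = P j` then have costs whose `lam`-average is
the mean squared distance of two independent samples from the `X i`, and this is at most twice the
mean squared distance to `X` (`cost_le_two_mul_phi`).

The size. Each point `s l` is spread to at most `∑ i, |P i| - N + 1` centroids, because every move
exhausts a support point and the last one exhausts `N` of them at once; and a vertex has at most
`∑ i, |P i| - N + 1` points `s l` (`card_add_le_of_mem_extremePoints`).
-/

namespace WBary

variable {d N r : ℕ}

/-! ### Centroids -/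

/-- Huygens' identity: the weighted squared distances to the points `q i` are minimal at the
centroid, with the squared distance to the centroid as excess. -/
theorem sum_sq_dist_eq {lam : Fin N → ℝ} (hlam : ∑ i, lam i = 1) (q : Fin N → Pt d) (a : Pt d) :
    ∑ i, lam i * ‖a - q i‖ ^ 2 =
      ‖centroid lam q - a‖ ^ 2 + ∑ i, lam i * ‖centroid lam q - q i‖ ^ 2 := by
  have h0 : ∑ i, lam i • (centroid lam q - q i) = 0 := by
    simp only [smul_sub, Finset.sum_sub_distrib, ← Finset.sum_smul, hlam, one_smul]
    simp [centroid]
  have h1 : ∑ i, lam i * inner ℝ (a - centroid lam q) (centroid lam q - q i) = 0 := by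
    have := congrArg (fun v => inner ℝ (a - centroid lam q) v) h0
    simpa [inner_sum, inner_smul_right] using this
  have h2 : ∀ i, lam i * ‖a - q i‖ ^ 2 = lam i * ‖centroid lam q - a‖ ^ 2
      + 2 * (lam i * inner ℝ (a - centroid lam q) (centroid lam q - q i))
      + lam i * ‖centroid lam q - q i‖ ^ 2 := by
    intro i
    have : a - q i = (a - centroid lam q) + (centroid lam q - q i) := by abel
    rw [this, norm_add_sq_real, norm_sub_rev (centroid lam q) a]
    ring
  rw [Finset.sum_congr rfl fun i _ => h2 i, Finset.sum_add_distrib, Finset.sum_add_distrib,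
    ← Finset.mul_sum, h1, ← Finset.sum_mul, hlam]
  ring

theorem sum_sq_dist_centroid_le {lam : Fin N → ℝ} (hlam : ∑ i, lam i = 1) (q : Fin N → Pt d)
    (a : Pt d) :
    ∑ i, lam i * ‖centroid lam q - q i‖ ^ 2 ≤ ∑ i, lam i * ‖a - q i‖ ^ 2 := by
  rw [sum_sq_dist_eq hlam q a]
  linarith [sq_nonneg ‖centroid lam q - a‖]

theorem sum_sq_dist_sub_eq {lam : Fin N → ℝ} (hlam : ∑ i, lam i = 1) (q : Fin N → Pt d)
    (a b : Pt d) :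
    ∑ i, lam i * (‖a - q i‖ ^ 2 - ‖b - q i‖ ^ 2) =
      ‖centroid lam q - a‖ ^ 2 - ‖centroid lam q - b‖ ^ 2 := by
  simp only [mul_sub, Finset.sum_sub_distrib]
  rw [sum_sq_dist_eq hlam q a, sum_sq_dist_eq hlam q b]
  ring

/-- The centroid of points that are extreme in direction `a - b` is, among all centroids, the
relatively closest one to `a` as compared to `b`. -/
theorem sq_dist_centroid_sub_le {lam : Fin N → ℝ} (hlam_pos : ∀ i, 0 < lam i)
    {q q' : Fin N → Pt d} {a b : Pt d}
    (h : ∀ i, inner ℝ (a - b) (q' i) ≤ inner ℝ (a - b) (q i)) :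
    ‖centroid lam q' - b‖ ^ 2 - ‖centroid lam q' - a‖ ^ 2 ≤
      ‖centroid lam q - b‖ ^ 2 - ‖centroid lam q - a‖ ^ 2 := by
  have key : ∀ c : Pt d, ‖c - b‖ ^ 2 - ‖c - a‖ ^ 2 =
      2 * inner ℝ (a - b) c + (‖b‖ ^ 2 - ‖a‖ ^ 2) := by
    intro c
    rw [norm_sub_sq_real, norm_sub_sq_real, inner_sub_left, real_inner_comm a c,
      real_inner_comm b c]
    ring
  have hc : inner ℝ (a - b) (centroid lam q') ≤ inner ℝ (a - b) (centroid lam q) := by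
    simp only [centroid, inner_sum, inner_smul_right]
    exact Finset.sum_le_sum fun i _ => mul_le_mul_of_nonneg_left (h i) (hlam_pos i).le
  rw [key, key]
  linarith

/-- The lexicographic order on points is compatible with positive combinations. -/
theorem centroid_ne_of_lex_lt {lam : Fin N → ℝ} (hlam_pos : ∀ i, 0 < lam i)
    {q q' : Fin N → Pt d}
    (hle : ∀ i, toLex (fun a : Fin d => q' i a) ≤ toLex (fun a : Fin d => q i a))
    {i₀ : Fin N} (hne : q' i₀ ≠ q i₀) : centroid lam q' ≠ centroid lam q := by
  have smul_lt : ∀ (t : ℝ), 0 < t → ∀ u v : Pt d,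
      toLex (fun a : Fin d => u a) < toLex (fun a : Fin d => v a) →
      toLex (fun a : Fin d => t * u a) < toLex (fun a : Fin d => t * v a) := by
    rintro t ht u v ⟨a, ha, hlt⟩
    refine ⟨a, fun b hb => ?_, mul_lt_mul_of_pos_left hlt ht⟩
    exact congrArg (t * ·) (ha b hb)
  have toLex_inj : ∀ u v : Pt d,
      toLex (fun a : Fin d => u a) = toLex (fun a : Fin d => v a) → u = v := by
    intro u v h
    ext a
    exact congrFun (toLex_inj.1 h) a
  have hlt : ∑ i, toLex (fun a : Fin d => lam i * q' i a) <
      ∑ i, toLex (fun a : Fin d => lam i * q i a) := by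
    refine Finset.sum_lt_sum (fun i _ => ?_) ⟨i₀, Finset.mem_univ _, ?_⟩
    · rcases (hle i).eq_or_lt with h | h
      · rw [toLex_inj _ _ h]
      · exact (smul_lt _ (hlam_pos i) _ _ h).le
    · exact smul_lt _ (hlam_pos i₀) _ _ ((hle i₀).lt_of_ne fun h => hne (toLex_inj _ _ h))
  have key : ∀ p : Fin N → Pt d, ∑ i, toLex (fun a : Fin d => lam i * p i a) =
      toLex (fun a : Fin d => centroid lam p a) := by
    intro p
    refine ofLex_inj.1 (funext fun a => ?_)
    have : ∀ t : Finset (Fin N), ofLex (∑ i ∈ t, toLex (fun a : Fin d => lam i * p i a)) a =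
        ∑ i ∈ t, lam i * p i a := by
      intro t
      induction t using Finset.induction_on with
      | empty => rfl
      | insert b t hb ih => rw [Finset.sum_insert hb, Finset.sum_insert hb, ← ih]; rfl
    rw [this]
    simp [centroid]
  rw [key, key] at hlt
  intro h
  rw [h] at hlt
  exact lt_irrefl _ hlt

/-! ### Bookkeeping of a single move -/

theorem State.remove_part (σ : State d N r) (l : Fin r) (q : Fin N → Pt d) (m : ℝ) (l' : Fin r)
    (i : Fin N) :
    (σ.remove l q m).part l' i =
      σ.part l' i - if l' = l then Finsupp.single (q i) m else 0 := by
  by_cases h : l' = l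
  · subst h; simp [State.remove]
  · simp [State.remove, h]

theorem State.remove_mass (σ : State d N r) (l : Fin r) (q : Fin N → Pt d) (m : ℝ)
    (l' : Fin r) :
    (σ.remove l q m).mass l' = σ.mass l' - if l' = l then m else 0 := by
  by_cases h : l' = l
  · subst h; simp [State.remove]
  · simp [State.remove, h]

theorem State.insert_part (σ : State d N r) (j : Fin r) (q : Fin N → Pt d) (m : ℝ) (l' : Fin r)
    (i : Fin N) :
    (σ.insert j q m).part l' i =
      σ.part l' i + if l' = j then Finsupp.single (q i) m else 0 := by
  by_cases h : l' = j
  · subst h; simp [State.insert]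
  · simp [State.insert, h]

theorem State.insert_mass (σ : State d N r) (j : Fin r) (q : Fin N → Pt d) (m : ℝ)
    (l' : Fin r) :
    (σ.insert j q m).mass l' = σ.mass l' + if l' = j then m else 0 := by
  by_cases h : l' = j
  · subst h; simp [State.insert]
  · simp [State.insert, h]

/-- Every mass `d_l` is the common total of the nonnegative partial measures `P_i^l`, which live
on the support of `P_i`. -/
structure Balanced (P : Fin N → Mass d) (σ : State d N r) : Prop where
  nonneg : ∀ l i k, 0 ≤ σ.part l i k
  supp : ∀ l i k, σ.part l i k ≠ 0 → k ∈ (P i).support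
  total : ∀ l i, ∑ k ∈ (P i).support, σ.part l i k = σ.mass l

theorem sum_single_of_mem {s : Finset (Pt d)} {a : Pt d} (ha : a ∈ s) (m : ℝ) :
    ∑ k ∈ s, Finsupp.single a m k = m := by
  classical
  simp [Finsupp.single_apply, ha]

theorem IsMinMass.pos {P : Fin N → Mass d} {σ : State d N r} (hσ : Balanced P σ) {l : Fin r}
    {q : Fin N → Pt d} (hq : ∀ i, q i ∈ (σ.part l i).support) {m : ℝ} (hm : IsMinMass σ l q m) :
    0 < m := by
  obtain ⟨i, rfl⟩ := hm.1
  exact lt_of_le_of_ne (hσ.nonneg _ _ _) (Ne.symm (Finsupp.mem_support_iff.1 (hq i)))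

theorem IsMinMass.le {σ : State d N r} {l : Fin r} {q : Fin N → Pt d} {m : ℝ}
    (hm : IsMinMass σ l q m) (i : Fin N) : m ≤ σ.part l i (q i) :=
  hm.2 ⟨i, rfl⟩

theorem exists_isMinMass (hN : 0 < N) (σ : State d N r) (l : Fin r) (q : Fin N → Pt d) :
    ∃ m, IsMinMass σ l q m := by
  have : Nonempty (Fin N) := ⟨⟨0, hN⟩⟩
  obtain ⟨i, hi⟩ := Finite.exists_min fun i => σ.part l i (q i)
  exact ⟨_, ⟨i, rfl⟩, by rintro _ ⟨j, rfl⟩; exact hi j⟩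

namespace Balanced

variable {P : Fin N → Mass d} {σ : State d N r}

theorem support_subset (hσ : Balanced P σ) (l : Fin r) (i : Fin N) :
    (σ.part l i).support ⊆ (P i).support :=
  fun k hk => hσ.supp l i k (Finsupp.mem_support_iff.1 hk)

theorem support_nonempty (hσ : Balanced P σ) {l : Fin r} (hl : 0 < σ.mass l) (i : Fin N) :
    (σ.part l i).support.Nonempty := by
  rw [Finsupp.support_nonempty_iff]
  intro h
  have := hσ.total l i
  simp only [h, Finsupp.coe_zero, Pi.zero_apply, Finset.sum_const_zero] at this
  exact hl.ne this

theorem part_eq_zero (hσ : Balanced P σ) {l : Fin r} (hl : σ.mass l ≤ 0) (i : Fin N) :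
    σ.part l i = 0 := by
  ext k
  by_contra hk
  have h0 := hσ.total l i
  have hk' := hσ.supp l i k hk
  have hle : σ.part l i k ≤ ∑ k ∈ (P i).support, σ.part l i k :=
    Finset.single_le_sum (f := fun k => σ.part l i k) (fun k _ => hσ.nonneg l i k) hk'
  exact hk (le_antisymm (hle.trans (h0.trans_le hl)) (hσ.nonneg l i k))

theorem remove (hσ : Balanced P σ) {l : Fin r} {q : Fin N → Pt d}
    (hq : ∀ i, q i ∈ (σ.part l i).support) {m : ℝ} (hm : IsMinMass σ l q m) :
    Balanced P (σ.remove l q m) where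
  nonneg l' i k := by
    rw [State.remove_part]
    split_ifs with h
    · subst h
      by_cases hk : q i = k
      · subst hk
        simpa using hm.le i
      · simpa [Finsupp.single_eq_of_ne' hk] using hσ.nonneg l' i k
    · simpa using hσ.nonneg l' i k
  supp l' i k hk := by
    by_contra hkP
    have h0 : σ.part l' i k = 0 := by
      by_contra h
      exact hkP (hσ.supp l' i k h)
    have hqk : q i ≠ k := fun h => hkP (h ▸ hσ.support_subset l i (hq i))
    rw [State.remove_part] at hk
    split_ifs at hk
    · exact hk (by simp [h0, Finsupp.single_eq_of_ne' hqk])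
    · exact hk (by simp [h0])
  total l' i := by
    rw [State.remove_part, State.remove_mass]
    split_ifs
    · simp only [Finsupp.coe_sub, Pi.sub_apply, Finset.sum_sub_distrib]
      rw [hσ.total, sum_single_of_mem (hσ.support_subset l i (hq i))]
    · simpa using hσ.total l' i

theorem insert (hσ : Balanced P σ) (j : Fin r) {q : Fin N → Pt d}
    (hq : ∀ i, q i ∈ (P i).support) {m : ℝ} (hm : 0 ≤ m) : Balanced P (σ.insert j q m) where
  nonneg l' i k := by
    rw [State.insert_part]
    split_ifs with h
    · rw [Finsupp.add_apply]
      refine add_nonneg (hσ.nonneg _ _ _) ?_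
      by_cases hk : q i = k
      · subst hk; simpa using hm
      · simp [Finsupp.single_eq_of_ne' hk]
    · simpa using hσ.nonneg l' i k
  supp l' i k hk := by
    by_contra hkP
    have h0 : σ.part l' i k = 0 := by
      by_contra h
      exact hkP (hσ.supp l' i k h)
    have hqk : q i ≠ k := fun h => hkP (h ▸ hq i)
    rw [State.insert_part] at hk
    split_ifs at hk
    · exact hk (by simp [h0, Finsupp.single_eq_of_ne' hqk])
    · exact hk (by simp [h0])
  total l' i := by
    rw [State.insert_part, State.insert_mass]
    split_ifs
    · simp only [Finsupp.coe_add, Pi.add_apply, Finset.sum_add_distrib]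
      rw [hσ.total, sum_single_of_mem (hq i)]
    · simpa using hσ.total l' i

theorem emit (hσ : Balanced P σ) (l : Fin r) (c : Pt d) (m : ℝ) : Balanced P (σ.emit l c m) :=
  ⟨hσ.nonneg, hσ.supp, hσ.total⟩

end Balanced

theorem State.support_remove_subset (σ : State d N r) {l : Fin r} {q : Fin N → Pt d}
    (hq : ∀ i, q i ∈ (σ.part l i).support) (m : ℝ) (l' : Fin r) (i : Fin N) :
    ((σ.remove l q m).part l' i).support ⊆ (σ.part l' i).support := by
  intro k hk
  rw [State.remove_part] at hk
  by_contra h0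
  rw [Finsupp.notMem_support_iff] at h0
  rw [Finsupp.mem_support_iff] at hk
  split_ifs at hk with h
  · subst h
    have hqk : q i ≠ k := fun h => Finsupp.mem_support_iff.1 (hq i) (h ▸ h0)
    exact hk (by simp [h0, Finsupp.single_eq_of_ne' hqk])
  · exact hk (by simp [h0])

/-- Removing the minimal mass of the points `q i` exhausts one of them. -/
theorem State.exists_notMem_support_remove (σ : State d N r) {l : Fin r} {q : Fin N → Pt d}
    {m : ℝ} (hm : IsMinMass σ l q m) : ∃ i, q i ∉ ((σ.remove l q m).part l i).support := by
  obtain ⟨i, hi⟩ := hm.1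
  refine ⟨i, ?_⟩
  rw [Finsupp.notMem_support_iff, State.remove_part, if_pos rfl]
  simp only at hi
  simp [hi]

theorem State.sum_card_remove_lt (σ : State d N r) {l : Fin r} {q : Fin N → Pt d}
    (hq : ∀ i, q i ∈ (σ.part l i).support) {m : ℝ} (hm : IsMinMass σ l q m) :
    ∑ i, ((σ.remove l q m).part l i).support.card < ∑ i, (σ.part l i).support.card := by
  obtain ⟨i, hi⟩ := σ.exists_notMem_support_remove hm
  refine Finset.sum_lt_sum
    (fun i _ => Finset.card_le_card (σ.support_remove_subset hq m l i)) ⟨i, Finset.mem_univ _, ?_⟩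
  exact Finset.card_lt_card ((Finset.ssubset_iff_of_subset
    (σ.support_remove_subset hq m l i)).2 ⟨q i, hq i, hi⟩)

/-! ### Termination -/

/-- The index whose partial measures are consumed by a loop. -/
def Instr.source : Instr r → Fin r
  | .shift l _ => l
  | .spread l => l

/-- The number of remaining loops and the number of support points that the current loop can
still exhaust, ordered lexicographically: a step leaves the loop or exhausts a point. -/
def progressMeasure (c : Config d N r) : ℕ ×ₗ ℕ :=
  toLex (c.1.length, match c.1 with
    | [] => 0
    | I :: _ => ∑ i, (c.2.part I.source i).support.card)

theorem progressMeasure_lt_of_length {c c' : Config d N r} (h : c'.1.length < c.1.length) :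
    progressMeasure c' < progressMeasure c :=
  Prod.Lex.left _ _ h

/-- Mass is only shifted between distinct points. -/
def ShiftsDistinct (is : List (Instr r)) : Prop := ∀ l j, Instr.shift l j ∈ is → l ≠ j

theorem ShiftsDistinct.tail {I : Instr r} {is : List (Instr r)} (h : ShiftsDistinct (I :: is)) :
    ShiftsDistinct is :=
  fun l j hlj => h l j (List.mem_cons_of_mem _ hlj)

theorem State.support_remove_insert_subset (σ : State d N r) {l j l' : Fin r} {q : Fin N → Pt d}
    (hq : ∀ i, q i ∈ (σ.part l i).support) (m : ℝ) (hl' : l' ≠ j) (i : Fin N) :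
    (((σ.remove l q m).insert j q m).part l' i).support ⊆ (σ.part l' i).support := by
  rw [State.insert_part, if_neg hl', add_zero]
  exact σ.support_remove_subset hq m l' i

theorem step_invariant {lam : Fin N → ℝ} {P : Fin N → Mass d} {s : Fin r → Pt d}
    {c c' : Config d N r} (h : Step lam s c c') (hb : Balanced P c.2) (hd : ShiftsDistinct c.1) :
    Balanced P c'.2 ∧ ShiftsDistinct c'.1 ∧ progressMeasure c' < progressMeasure c := by
  cases h with
  | shift_move l j is σ q m hpos hq heq hm =>
    have hq' := fun i => (hq i).1
    have hlj : l ≠ j := hd l j List.mem_cons_self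
    refine ⟨(hb.remove hq' hm).insert j (fun i => hb.support_subset l i (hq' i))
      (hm.pos hb hq').le, hd, Prod.Lex.right _ ?_⟩
    have := σ.sum_card_remove_lt hq' hm
    simp only [Instr.source, State.insert_part, if_neg hlj, add_zero]
    exact this
  | shift_stop l j is σ q hpos hq hne =>
    exact ⟨hb, hd.tail, progressMeasure_lt_of_length (by simp)⟩
  | shift_exit l j is σ hpos =>
    exact ⟨hb, hd.tail, progressMeasure_lt_of_length (by simp)⟩
  | spread_move l is σ q m hpos hq hm =>
    have hq' := fun i => (hq i).1
    exact ⟨(hb.remove hq' hm).emit _ _ _, hd, Prod.Lex.right _ (σ.sum_card_remove_lt hq' hm)⟩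
  | spread_exit l is σ hpos =>
    exact ⟨hb, hd.tail, progressMeasure_lt_of_length (by simp)⟩

theorem exists_step {lam : Fin N → ℝ} {P : Fin N → Mass d} (hN : 0 < N) {s : Fin r → Pt d}
    {c : Config d N r} (hb : Balanced P c.2) (hc : c.1 ≠ []) : ∃ c', Step lam s c c' := by
  obtain ⟨is, σ⟩ := c
  cases is with
  | nil => exact absurd rfl hc
  | cons I is =>
    cases I with
    | shift l j =>
      by_cases hpos : 0 < σ.mass l
      · have hex : ∀ i, ∃ x ∈ (σ.part l i).support, ∀ x' ∈ (σ.part l i).support,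
            inner ℝ (s j - s l) x' ≤ inner ℝ (s j - s l) x := fun i =>
          Finset.exists_max_image _ _ (hb.support_nonempty hpos i)
        choose q hq using hex
        by_cases heq : ‖centroid lam q - s j‖ ^ 2 = ‖centroid lam q - s l‖ ^ 2
        · obtain ⟨m, hm⟩ := exists_isMinMass hN σ l q
          exact ⟨_, Step.shift_move l j is σ q m hpos hq heq hm⟩
        · exact ⟨_, Step.shift_stop l j is σ q hpos hq heq⟩
      · exact ⟨_, Step.shift_exit l j is σ hpos⟩
    | spread l =>
      by_cases hpos : 0 < σ.mass l
      · have hex : ∀ i, ∃ x ∈ (σ.part l i).support, ∀ x' ∈ (σ.part l i).support,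
            toLex (fun a : Fin d => x' a) ≤ toLex (fun a : Fin d => x a) := fun i =>
          Finset.exists_max_image _ _ (hb.support_nonempty hpos i)
        choose q hq using hex
        obtain ⟨m, hm⟩ := exists_isMinMass hN σ l q
        exact ⟨_, Step.spread_move l is σ q m hpos hq hm⟩
      · exact ⟨_, Step.spread_exit l is σ hpos⟩

/-- Runs are finite and can only end when the whole program has been executed. -/
theorem alwaysReturns_of_balanced {lam : Fin N → ℝ} {P : Fin N → Mass d} (hN : 0 < N)
    {s : Fin r → Pt d} {c₀ : Config d N r} (hb : Balanced P c₀.2) (hd : ShiftsDistinct c₀.1) :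
    AlwaysReturns lam s c₀ := by
  constructor
  · rintro ⟨f, hf0, hf⟩
    have hinv : ∀ n, Balanced P (f n).2 ∧ ShiftsDistinct (f n).1 := by
      intro n
      induction n with
      | zero => rw [hf0]; exact ⟨hb, hd⟩
      | succ n ih =>
        have := step_invariant (hf n) ih.1 ih.2
        exact ⟨this.1, this.2.1⟩
    obtain ⟨n, hn⟩ := WellFounded.not_rel_apply_succ (r := (· < ·)) fun n => progressMeasure (f n)
    exact hn (step_invariant (hf n) (hinv n).1 (hinv n).2).2.2
  · intro c hc hstuck
    have hinv : Balanced P c.2 ∧ ShiftsDistinct c.1 := by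
      clear hstuck
      induction hc with
      | refl => exact ⟨hb, hd⟩
      | tail _ hstep ih =>
        have := step_invariant hstep ih.1 ih.2
        exact ⟨this.1, this.2.1⟩
    by_contra hne
    obtain ⟨c', hc'⟩ := exists_step (lam := lam) (s := s) hN hinv.1 hne
    exact hstuck c' hc'

/-! ### The program -/

/-- The loops of the shifting phase. -/
def shiftList (r : ℕ) : List (Instr r) :=
  (List.finRange r).reverse.flatMap fun l =>
    ((List.finRange r).filter fun j => j < l).map fun j => Instr.shift l j

/-- The loops of the spreading phase. -/
def spreadList (r : ℕ) : List (Instr r) := (List.finRange r).map fun l => Instr.spread l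

theorem program_eq : program r = shiftList r ++ spreadList r := rfl

theorem mem_shiftList {I : Instr r} :
    I ∈ shiftList r ↔ ∃ l j : Fin r, j < l ∧ I = Instr.shift l j := by
  simp [shiftList, eq_comm]

theorem mem_spreadList {I : Instr r} : I ∈ spreadList r ↔ ∃ l, I = Instr.spread l := by
  simp [spreadList, eq_comm]

theorem shiftsDistinct_program : ShiftsDistinct (program r) := by
  intro l j h
  rw [program_eq, List.mem_append, mem_shiftList, mem_spreadList] at h
  rcases h with ⟨l', j', hlt, h⟩ | ⟨l', h⟩
  · cases h
    exact hlt.ne'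
  · cases h

theorem pairwise_shiftList : (shiftList r).Pairwise fun I J => J.source ≤ I.source := by
  unfold shiftList
  rw [List.pairwise_flatMap]
  constructor
  · intro l _
    rw [List.pairwise_map]
    exact List.pairwise_of_forall fun _ _ => le_rfl
  · rw [List.pairwise_reverse]
    refine (List.pairwise_lt_finRange r).imp fun {a b} hab x hx y hy => ?_
    simp only [List.mem_map] at hx hy
    obtain ⟨_, _, rfl⟩ := hx
    obtain ⟨_, _, rfl⟩ := hy
    exact hab.le

/-! ### Optimality during the shifting phase -/

/-- The partial measures of a state form a transport from the masses at the points `s l` to the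
measures `P i`. -/
structure Feasible (P : Fin N → Mass d) (σ : State d N r) : Prop extends Balanced P σ where
  col : ∀ i, ∑ l, σ.part l i = P i

/-- The cost of transporting the partial measures from the points `s l`. -/
noncomputable def partCost (lam : Fin N → ℝ) (P : Fin N → Mass d) (s : Fin r → Pt d)
    (part : Fin r → Fin N → Mass d) : ℝ :=
  ∑ l, ∑ i, lam i * ∑ k ∈ (P i).support, ‖s l - k‖ ^ 2 * part l i k

/-- The state is a cheapest transport with mass located at the points `s l`. -/
def IsCheapest (lam : Fin N → ℝ) (P : Fin N → Mass d) (s : Fin r → Pt d) (σ : State d N r) :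
    Prop :=
  Feasible P σ ∧ ∀ σ' : State d N r, Feasible P σ' →
    partCost lam P s σ.part ≤ partCost lam P s σ'.part

theorem Feasible.remove_insert {P : Fin N → Mass d} {σ : State d N r} (hσ : Feasible P σ)
    {l j : Fin r} {q : Fin N → Pt d} (hq : ∀ i, q i ∈ (σ.part l i).support) {m : ℝ}
    (hm : IsMinMass σ l q m) : Feasible P ((σ.remove l q m).insert j q m) where
  toBalanced := (hσ.toBalanced.remove hq hm).insert j
    (fun i => hσ.support_subset l i (hq i)) (hm.pos hσ.toBalanced hq).le
  col i := by
    simp only [State.insert_part, State.remove_part, Finset.sum_add_distrib,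
      Finset.sum_sub_distrib, Finset.sum_ite_eq', Finset.mem_univ, if_true, hσ.col]
    abel

theorem partCost_remove_insert {lam : Fin N → ℝ} (hlam : ∑ i, lam i = 1) {P : Fin N → Mass d}
    (s : Fin r → Pt d) (σ : State d N r) (l j : Fin r) {q : Fin N → Pt d}
    (hq : ∀ i, q i ∈ (P i).support) (m : ℝ) :
    partCost lam P s ((σ.remove l q m).insert j q m).part = partCost lam P s σ.part +
      m * (‖centroid lam q - s j‖ ^ 2 - ‖centroid lam q - s l‖ ^ 2) := by
  have hsingle : ∀ l₀ : Fin r, ∑ l', ∑ i, lam i * ∑ k ∈ (P i).support,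
      ‖s l' - k‖ ^ 2 * (if l' = l₀ then Finsupp.single (q i) m else 0 : Mass d) k =
        ∑ i, lam i * ‖s l₀ - q i‖ ^ 2 * m := by
    intro l₀
    rw [Finset.sum_eq_single l₀]
    · refine Finset.sum_congr rfl fun i _ => ?_
      rw [if_pos rfl, Finset.sum_eq_single (q i)]
      · rw [Finsupp.single_eq_same, mul_assoc]
      · intro k _ hk
        rw [Finsupp.single_eq_of_ne hk, mul_zero]
      · exact fun h => absurd (hq i) h
    · intro l' _ hl'
      simp [hl']
    · simp
  have h := sum_sq_dist_sub_eq hlam q (s j) (s l)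
  simp only [mul_sub, Finset.sum_sub_distrib] at h
  simp only [partCost, State.insert_part, State.remove_part, Finsupp.add_apply,
    Finsupp.sub_apply, mul_add, mul_sub, Finset.sum_add_distrib, Finset.sum_sub_distrib, hsingle,
    ← Finset.sum_mul]
  linear_combination m * h

/-- In a cheapest transport the points `q i` fed from `s l` have a centroid that is at least as
close to `s l` as to any other `s j`: otherwise mass could be moved to `s j`. -/
theorem IsCheapest.sq_dist_centroid_le {lam : Fin N → ℝ} (hlam : ∑ i, lam i = 1) (hN : 0 < N)
    {P : Fin N → Mass d} {s : Fin r → Pt d} {σ : State d N r} (hσ : IsCheapest lam P s σ)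
    {l : Fin r} (j : Fin r) {q : Fin N → Pt d} (hq : ∀ i, q i ∈ (σ.part l i).support) :
    ‖centroid lam q - s l‖ ^ 2 ≤ ‖centroid lam q - s j‖ ^ 2 := by
  obtain ⟨m, hm⟩ := exists_isMinMass hN σ l q
  have h := hσ.2 _ (hσ.1.remove_insert (j := j) hq hm)
  rw [partCost_remove_insert hlam s σ l j (fun i => hσ.1.support_subset l i (hq i))] at h
  have hpos := hm.pos hσ.1.toBalanced hq
  by_contra! hlt
  nlinarith

theorem IsCheapest.remove_insert {lam : Fin N → ℝ} (hlam : ∑ i, lam i = 1)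
    {P : Fin N → Mass d} {s : Fin r → Pt d} {σ : State d N r} (hσ : IsCheapest lam P s σ)
    {l j : Fin r} {q : Fin N → Pt d} (hq : ∀ i, q i ∈ (σ.part l i).support) {m : ℝ}
    (hm : IsMinMass σ l q m)
    (heq : ‖centroid lam q - s j‖ ^ 2 = ‖centroid lam q - s l‖ ^ 2) :
    IsCheapest lam P s ((σ.remove l q m).insert j q m) := by
  refine ⟨hσ.1.remove_insert hq hm, fun σ' hσ' => ?_⟩
  rw [partCost_remove_insert hlam s σ l j (fun i => hσ.1.support_subset l i (hq i)), heq,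
    sub_self, mul_zero, add_zero]
  exact hσ.2 σ' hσ'

/-- All centroids of points fed from `s l` are strictly closer to `s l` than to `s j`. -/
def StrictlyCloser (lam : Fin N → ℝ) (s : Fin r → Pt d) (σ : State d N r) (l j : Fin r) : Prop :=
  ∀ q : Fin N → Pt d, (∀ i, q i ∈ (σ.part l i).support) →
    ‖centroid lam q - s l‖ ^ 2 < ‖centroid lam q - s j‖ ^ 2

theorem StrictlyCloser.of_mass_nonpos {lam : Fin N → ℝ} (hN : 0 < N) {P : Fin N → Mass d}
    {s : Fin r → Pt d} {σ : State d N r} (hσ : Balanced P σ) {l : Fin r} (hl : σ.mass l ≤ 0)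
    (j : Fin r) : StrictlyCloser lam s σ l j := by
  intro q hq
  have := hq ⟨0, hN⟩
  rw [hσ.part_eq_zero hl] at this
  simp at this

/-- It suffices to test the centroid that is extreme in direction `s j - s l`. -/
theorem StrictlyCloser.of_isArgmaxChoice {lam : Fin N → ℝ} (hlam_pos : ∀ i, 0 < lam i)
    {s : Fin r → Pt d} {σ : State d N r} {l j : Fin r} {q : Fin N → Pt d}
    (hq : IsArgmaxChoice s σ l j q)
    (hlt : ‖centroid lam q - s l‖ ^ 2 < ‖centroid lam q - s j‖ ^ 2) :
    StrictlyCloser lam s σ l j := by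
  intro q' hq'
  have := sq_dist_centroid_sub_le hlam_pos (a := s j) (b := s l)
    fun i => (hq i).2 (q' i) (hq' i)
  linarith

/-- The invariant of the shifting phase after the loops `pre`: the transport is still a cheapest
one, nothing has been output, and the loops `pre` have achieved their purpose. -/
structure ShiftInv (lam : Fin N → ℝ) (P : Fin N → Mass d) (s : Fin r → Pt d) (C : ℝ)
    (pre : List (Instr r)) (σ : State d N r) : Prop where
  cheapest : IsCheapest lam P s σ
  cost_eq : partCost lam P s σ.part = C
  out_eq : ∀ l, σ.out l = 0
  closer : ∀ l j, Instr.shift l j ∈ pre → StrictlyCloser lam s σ l j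

theorem ShiftInv.append {lam : Fin N → ℝ} {P : Fin N → Mass d} {s : Fin r → Pt d} {C : ℝ}
    {pre : List (Instr r)} {σ : State d N r} (h : ShiftInv lam P s C pre σ) {l j : Fin r}
    (hlj : StrictlyCloser lam s σ l j) :
    ShiftInv lam P s C (pre ++ [Instr.shift l j]) σ where
  cheapest := h.cheapest
  cost_eq := h.cost_eq
  out_eq := h.out_eq
  closer l' j' hmem := by
    rw [List.mem_append, List.mem_singleton] at hmem
    rcases hmem with hmem | hmem
    · exact h.closer l' j' hmem
    · cases hmem
      exact hlj

theorem ShiftInv.step {lam : Fin N → ℝ} (hlam_pos : ∀ i, 0 < lam i) (hlam : ∑ i, lam i = 1)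
    (hN : 0 < N) {P : Fin N → Mass d} {s : Fin r → Pt d} {C : ℝ} {pre L : List (Instr r)}
    {I : Instr r} {σ : State d N r} (hlist : shiftList r = pre ++ I :: L)
    (h : ShiftInv lam P s C pre σ) {is : List (Instr r)} {c : Config d N r}
    (hstep : Step lam s (I :: is, σ) c) :
    (c.1 = I :: is ∧ ShiftInv lam P s C pre c.2) ∨
      (c.1 = is ∧ ShiftInv lam P s C (pre ++ [I]) c.2) := by
  have hI : I ∈ shiftList r := by simp [hlist]
  obtain ⟨l, j, hjl, rfl⟩ := mem_shiftList.1 hI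
  cases hstep with
  | shift_move l j is σ q m hpos hq heq hm =>
    have hq' := fun i => (hq i).1
    refine Or.inl ⟨rfl, h.cheapest.remove_insert hlam hq' hm heq, ?_, h.out_eq, ?_⟩
    · simp only
      rw [partCost_remove_insert hlam s σ l j
        (fun i => h.cheapest.1.support_subset l i (hq' i)), heq, h.cost_eq]
      ring
    · intro l' j' hmem q' hq''
      -- Loops run with descending source, so the receiving index `j < l` has not been a source.
      have hle : l ≤ l' := by
        have hp := pairwise_shiftList (r := r)
        rw [hlist, List.pairwise_append] at hp
        exact hp.2.2 _ hmem _ List.mem_cons_self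
      have hne : l' ≠ j := (hjl.trans_le hle).ne'
      exact h.closer l' j' hmem q' fun i =>
        σ.support_remove_insert_subset hq' m hne i (hq'' i)
  | shift_stop l j is σ q hpos hq hne =>
    refine Or.inr ⟨rfl, h.append (StrictlyCloser.of_isArgmaxChoice hlam_pos hq ?_)⟩
    exact lt_of_le_of_ne (h.cheapest.sq_dist_centroid_le hlam hN j fun i => (hq i).1) hne.symm
  | shift_exit l j is σ hpos =>
    exact Or.inr ⟨rfl, h.append
      (StrictlyCloser.of_mass_nonpos hN h.cheapest.1.toBalanced (not_lt.1 hpos) j)⟩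

/-- After the shifting phase, different points `s l` feed different centroids. -/
theorem ShiftInv.centroid_ne {lam : Fin N → ℝ} (hlam : ∑ i, lam i = 1) (hN : 0 < N)
    {P : Fin N → Mass d} {s : Fin r → Pt d} {C : ℝ} {σ : State d N r}
    (h : ShiftInv lam P s C (shiftList r) σ) {l j : Fin r} (hlj : l ≠ j) {q q' : Fin N → Pt d}
    (hq : ∀ i, q i ∈ (σ.part l i).support) (hq' : ∀ i, q' i ∈ (σ.part j i).support) :
    centroid lam q ≠ centroid lam q' := by
  wlog hlt : j < l generalizing l j q q'
  · exact (this hlj.symm hq' hq (lt_of_le_of_ne (not_lt.1 hlt) hlj)).symm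
  intro heq
  have h1 := h.closer l j (mem_shiftList.2 ⟨l, j, hlt, rfl⟩) q hq
  have h2 := h.cheapest.sq_dist_centroid_le hlam hN l hq'
  rw [heq] at h1
  exact absurd h2 (not_le.2 h1)

/-! ### The spreading phase -/

/-- The invariant of spreading a single point. The finitely supported measure `g` on tuples
records which tuples were chosen with which masses: together with the remaining partial measures
`part` its marginals make up the original ones `part₀`, and `out` is its image under the centroid
map. The chosen tuples lie lexicographically above all remaining points, which makes the
centroid map injective on them. -/
structure SpreadInvAt (lam : Fin N → ℝ) (P : Fin N → Mass d) (part₀ part : Fin N → Mass d)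
    (mass : ℝ) (out : Mass d) (g : (Fin N → Pt d) →₀ ℝ) : Prop where
  nonneg : ∀ q, 0 ≤ g q
  split : ∀ i, part i + g.mapDomain (fun q => q i) = part₀ i
  out_eq : out = g.mapDomain (centroid lam)
  above : ∀ q ∈ g.support, ∀ i, ∀ x ∈ (part i).support,
    toLex (fun a : Fin d => x a) ≤ toLex (fun a : Fin d => q i a)
  exhausted : ∀ q ∈ g.support, ∃ i, q i ∉ (part i).support
  injOn : Set.InjOn (centroid lam) (g.support : Set (Fin N → Pt d))
  card_add_le : 0 < mass → g.support.card + ∑ i, (part i).support.card ≤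
    ∑ i, (P i).support.card
  card_le : g.support.card + N ≤ ∑ i, (P i).support.card + 1

theorem SpreadInvAt.start {lam : Fin N → ℝ} {P : Fin N → Mass d} {σ : State d N r}
    (hP : ∀ i, (P i).support.Nonempty) (hσ : Balanced P σ) (l : Fin r) :
    SpreadInvAt lam P (σ.part l) (σ.part l) (σ.mass l) 0 0 where
  nonneg q := le_rfl
  split i := by simp
  out_eq := by simp
  above q hq := by simp at hq
  exhausted q hq := by simp at hq
  injOn := by simp
  card_add_le _ := by
    simpa using Finset.sum_le_sum fun i _ => Finset.card_le_card (hσ.support_subset l i)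
  card_le := by
    have : ∑ _i : Fin N, 1 ≤ ∑ i, (P i).support.card :=
      Finset.sum_le_sum fun i _ => Finset.card_pos.2 (hP i)
    simp only [Finset.sum_const, Finset.card_univ, Fintype.card_fin, smul_eq_mul, mul_one] at this
    simpa using this.trans (Nat.le_succ _)

theorem SpreadInvAt.move {lam : Fin N → ℝ} (hlam_pos : ∀ i, 0 < lam i) {P : Fin N → Mass d}
    {σ : State d N r} (hσ : Balanced P σ) {l : Fin r} {part₀ : Fin N → Mass d} {out : Mass d}
    {g : (Fin N → Pt d) →₀ ℝ} (h : SpreadInvAt lam P part₀ (σ.part l) (σ.mass l) out g)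
    (hpos : 0 < σ.mass l) {q : Fin N → Pt d} (hq : IsLexMaxChoice σ l q) {m : ℝ}
    (hm : IsMinMass σ l q m) :
    SpreadInvAt lam P part₀ ((σ.remove l q m).part l) ((σ.remove l q m).mass l)
      (out + Finsupp.single (centroid lam q) m) (g + Finsupp.single q m) := by
  classical
  have hq' := fun i => (hq i).1
  have hm_pos := hm.pos hσ hq'
  have hsub : (g + Finsupp.single q m).support ⊆ Insert.insert q g.support := by
    intro q' hq''
    rcases Finset.mem_union.1 (Finsupp.support_add hq'') with h1 | h1
    · exact Finset.mem_insert_of_mem h1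
    · rw [Finset.mem_singleton.1 (Finsupp.support_single_subset h1)]
      exact Finset.mem_insert_self _ _
  have hcard : (g + Finsupp.single q m).support.card ≤ g.support.card + 1 :=
    (Finset.card_le_card hsub).trans (Finset.card_insert_le _ _)
  have hlt := σ.sum_card_remove_lt hq' hm
  have hbefore := h.card_add_le hpos
  have hne : ∀ q' ∈ g.support, centroid lam q ≠ centroid lam q' := by
    intro q' hq''
    obtain ⟨i, hi⟩ := h.exhausted q' hq''
    exact centroid_ne_of_lex_lt hlam_pos (fun i => h.above q' hq'' i (q i) (hq' i))
      (i₀ := i) fun heq => hi (heq ▸ hq' i)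
  refine ⟨fun q' => ?_, fun i => ?_, ?_, fun q' hq'' i x hx => ?_, fun q' hq'' => ?_, ?_,
    fun _ => ?_, ?_⟩
  · rw [Finsupp.add_apply]
    refine add_nonneg (h.nonneg q') ?_
    rw [Finsupp.single_apply]
    split_ifs
    exacts [hm_pos.le, le_rfl]
  · rw [State.remove_part, if_pos rfl, Finsupp.mapDomain_add, Finsupp.mapDomain_single,
      ← h.split i]
    abel
  · rw [Finsupp.mapDomain_add, Finsupp.mapDomain_single, h.out_eq]
  · have hx' := σ.support_remove_subset hq' m l i hx
    rcases Finset.mem_insert.1 (hsub hq'') with rfl | h1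
    · exact (hq i).2 x hx'
    · exact h.above q' h1 i x hx'
  · rcases Finset.mem_insert.1 (hsub hq'') with rfl | h1
    · exact σ.exists_notMem_support_remove hm
    · obtain ⟨i, hi⟩ := h.exhausted q' h1
      exact ⟨i, fun hmem => hi (σ.support_remove_subset hq' m l i hmem)⟩
  · intro q₁ h₁ q₂ h₂ heq
    rcases Finset.mem_insert.1 (hsub h₁) with rfl | h1 <;>
      rcases Finset.mem_insert.1 (hsub h₂) with rfl | h2
    · rfl
    · exact absurd heq (hne _ h2)
    · exact absurd heq.symm (hne _ h1)
    · exact h.injOn h1 h2 heq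
  · omega
  · -- Before the move every remaining partial measure is nonempty.
    have hN : ∑ _i : Fin N, 1 ≤ ∑ i, (σ.part l i).support.card :=
      Finset.sum_le_sum fun i _ => Finset.card_pos.2 (hσ.support_nonempty hpos i)
    simp only [Finset.sum_const, Finset.card_univ, Fintype.card_fin, smul_eq_mul, mul_one] at hN
    omega

/-- The invariant of the spreading phase started in the state `σ₀`, with the loops `is` still to
be executed. -/
structure SpreadInv (lam : Fin N → ℝ) (P : Fin N → Mass d) (σ₀ : State d N r)
    (is : List (Instr r)) (σ : State d N r) : Prop where
  isSpread : ∀ I ∈ is, ∃ l, I = Instr.spread l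
  balanced : Balanced P σ
  spread : ∃ G : Fin r → (Fin N → Pt d) →₀ ℝ, ∀ l,
    SpreadInvAt lam P (σ₀.part l) (σ.part l) (σ.mass l) (σ.out l) (G l)
  done : ∀ l, Instr.spread l ∈ is ∨ σ.mass l ≤ 0

theorem SpreadInv.start {lam : Fin N → ℝ} {P : Fin N → Mass d} {σ : State d N r}
    (hP : ∀ i, (P i).support.Nonempty) (hσ : Balanced P σ) (hout : ∀ l, σ.out l = 0) :
    SpreadInv lam P σ (spreadList r) σ where
  isSpread I hI := mem_spreadList.1 hI
  balanced := hσ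
  spread := ⟨fun _ => 0, fun l => by rw [hout l]; exact SpreadInvAt.start hP hσ l⟩
  done l := Or.inl (mem_spreadList.2 ⟨l, rfl⟩)

theorem SpreadInv.step {lam : Fin N → ℝ} (hlam_pos : ∀ i, 0 < lam i)
    {P : Fin N → Mass d} {s : Fin r → Pt d} {σ₀ : State d N r} {c c' : Config d N r}
    (h : SpreadInv lam P σ₀ c.1 c.2) (hstep : Step lam s c c') :
    SpreadInv lam P σ₀ c'.1 c'.2 := by
  cases hstep with
  | shift_move l j is σ q m hpos hq heq hm =>
    obtain ⟨_, h'⟩ := h.isSpread _ List.mem_cons_self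
    cases h'
  | shift_stop l j is σ q hpos hq hne =>
    obtain ⟨_, h'⟩ := h.isSpread _ List.mem_cons_self
    cases h'
  | shift_exit l j is σ hpos =>
    obtain ⟨_, h'⟩ := h.isSpread _ List.mem_cons_self
    cases h'
  | spread_exit l is σ hpos =>
    refine ⟨fun I hI => h.isSpread I (List.mem_cons_of_mem _ hI), h.balanced, h.spread,
      fun l' => ?_⟩
    rcases h.done l' with h' | h'
    · rcases List.mem_cons.1 h' with h'' | h''
      · cases h''
        exact Or.inr (not_lt.1 hpos)
      · exact Or.inl h''
    · exact Or.inr h'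
  | spread_move l is σ q m hpos hq hm =>
    obtain ⟨G, hG⟩ := h.spread
    have hq' := fun i => (hq i).1
    have hb : Balanced P (σ.remove l q m) := h.balanced.remove hq' hm
    refine ⟨h.isSpread, hb.emit _ _ _, ⟨Function.update G l (G l + Finsupp.single q m),
      fun l' => ?_⟩, fun l' => (h.done l').imp_right fun h' => ?_⟩
    · by_cases hl : l' = l
      · subst hl
        simpa [State.emit, State.remove] using (hG l').move hlam_pos h.balanced hpos hq hm
      · simpa [State.emit, State.remove, hl] using hG l'
    · simp only [State.emit, State.remove_mass]
      simp only at h'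
      split_ifs
      · linarith [hm.pos h.balanced hq']
      · linarith

/-- The outcome of a complete run. -/
theorem exists_spreadInv_of_reaches {lam : Fin N → ℝ} (hlam_pos : ∀ i, 0 < lam i)
    (hlam : ∑ i, lam i = 1) (hN : 0 < N) {P : Fin N → Mass d} (hP : ∀ i, (P i).support.Nonempty)
    {s : Fin r → Pt d} {C : ℝ} {σ₁ : State d N r} (h₁ : ShiftInv lam P s C [] σ₁)
    {σ : State d N r} (hreach : Reaches lam s (program r, σ₁) ([], σ)) :
    ∃ σ₀, ShiftInv lam P s C (shiftList r) σ₀ ∧ SpreadInv lam P σ₀ [] σ := by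
  have key : ∀ c : Config d N r, Reaches lam s (program r, σ₁) c →
      (∃ pre L, shiftList r = pre ++ L ∧ L ≠ [] ∧ c.1 = L ++ spreadList r ∧
        ShiftInv lam P s C pre c.2) ∨
      ∃ σ₀, ShiftInv lam P s C (shiftList r) σ₀ ∧ SpreadInv lam P σ₀ c.1 c.2 := by
    -- Once the shifting loops are used up, the spreading phase starts in the current state.
    have switch : ∀ (c : Config d N r) (pre L : List (Instr r)), shiftList r = pre ++ L →
        c.1 = L ++ spreadList r → ShiftInv lam P s C pre c.2 →
        (∃ pre L, shiftList r = pre ++ L ∧ L ≠ [] ∧ c.1 = L ++ spreadList r ∧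
          ShiftInv lam P s C pre c.2) ∨
        ∃ σ₀, ShiftInv lam P s C (shiftList r) σ₀ ∧ SpreadInv lam P σ₀ c.1 c.2 := by
      intro c pre L hpre hc hinv
      by_cases hL : L = []
      · subst hL
        rw [List.append_nil] at hpre
        rw [List.nil_append] at hc
        rw [← hpre] at hinv
        refine Or.inr ⟨c.2, hinv, ?_⟩
        rw [hc]
        exact SpreadInv.start hP hinv.cheapest.1.toBalanced hinv.out_eq
      · exact Or.inl ⟨pre, L, hpre, hL, hc, hinv⟩
    intro c hc
    induction hc with
    | refl => exact switch _ [] (shiftList r) rfl program_eq h₁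
    | @tail b c _ hstep ih =>
      rcases ih with ⟨pre, L, hpre, hL, hb, hinv⟩ | ⟨σ₀, hσ₀, hinv⟩
      · obtain ⟨I, L, rfl⟩ := List.exists_cons_of_ne_nil hL
        obtain ⟨is, τ⟩ := b
        simp only [List.cons_append] at hb
        subst hb
        rcases hinv.step hlam_pos hlam hN hpre hstep with ⟨hc1, hinv'⟩ | ⟨hc1, hinv'⟩
        · exact switch c pre (I :: L) hpre hc1 hinv'
        · exact switch c (pre ++ [I]) L (by simp [hpre]) hc1 hinv'
      · exact Or.inr ⟨σ₀, hσ₀, hinv.step hlam_pos hstep⟩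
  rcases key _ hreach with ⟨pre, L, _, hL, hc, _⟩ | h
  · exact absurd (List.append_eq_nil_iff.1 hc.symm).1 hL
  · exact h

/-! ### Transports given by tuples -/

theorem mapDomain_apply_eq_sum {α β : Type*} [DecidableEq β] (f : α → β) (Q : α →₀ ℝ) (b : β) :
    Q.mapDomain f b = ∑ q ∈ Q.support, if f q = b then Q q else 0 := by
  simp [Finsupp.mapDomain, Finsupp.sum, Finsupp.single_apply]

theorem mapDomain_nonneg {α β : Type*} (f : α → β) {Q : α →₀ ℝ} (hQ : ∀ q, 0 ≤ Q q) (b : β) :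
    0 ≤ Q.mapDomain f b := by
  classical
  rw [mapDomain_apply_eq_sum]
  exact Finset.sum_nonneg fun q _ => by split_ifs; exacts [hQ q, le_rfl]

theorem mem_support_mapDomain {α β : Type*} (f : α → β) {Q : α →₀ ℝ} (hQ : ∀ q, 0 ≤ Q q) {q : α}
    (hq : q ∈ Q.support) : f q ∈ (Q.mapDomain f).support := by
  classical
  rw [Finsupp.mem_support_iff, mapDomain_apply_eq_sum]
  refine (lt_of_lt_of_le (lt_of_le_of_ne (hQ q) (Finsupp.mem_support_iff.1 hq).symm) ?_).ne'
  refine le_trans ?_ (Finset.single_le_sum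
    (f := fun q' => if f q' = f q then Q q' else 0) (fun q' _ => ?_) hq)
  · simp
  · split_ifs
    exacts [hQ q', le_rfl]

theorem mem_support_of_mapDomain_eq {α β : Type*} {f : α → β} {Q : α →₀ ℝ} (hQ : ∀ q, 0 ≤ Q q)
    {p : β →₀ ℝ} (hp : Q.mapDomain f = p) {q : α} (hq : q ∈ Q.support) : f q ∈ p.support := by
  subst hp
  exact mem_support_mapDomain f hQ hq

theorem exists_of_mem_support_mapDomain {α β : Type*} {f : α → β} {Q : α →₀ ℝ} {b : β}
    (hb : b ∈ (Q.mapDomain f).support) : ∃ q ∈ Q.support, f q = b := by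
  classical
  simpa using Finsupp.mapDomain_support hb

open Classical in
/-- A finitely supported measure `Q` on tuples moves the mass of each tuple from its centroid to
its entries. -/
noncomputable def tuplePlan (lam : Fin N → ℝ) (Q : (Fin N → Pt d) →₀ ℝ) : Plan d N :=
  fun i x => ∑ q ∈ Q.support, if centroid lam q = x then Finsupp.single (q i) (Q q) else 0

open Classical in
theorem tuplePlan_apply (lam : Fin N → ℝ) (Q : (Fin N → Pt d) →₀ ℝ) (i : Fin N) (x k : Pt d) :
    tuplePlan lam Q i x k =
      ∑ q ∈ Q.support, if centroid lam q = x then if q i = k then Q q else 0 else 0 := by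
  rw [tuplePlan, Finsupp.finsetSum_apply]
  refine Finset.sum_congr rfl fun q _ => ?_
  split_ifs <;> simp [*]

section TuplePlan

variable {lam : Fin N → ℝ} {P : Fin N → Mass d} {Q : (Fin N → Pt d) →₀ ℝ}

theorem tuplePlan_isTransport (hQ : ∀ q, 0 ≤ Q q)
    (hmarg : ∀ i, Q.mapDomain (fun q => q i) = P i) :
    IsTransport P (Q.mapDomain (centroid lam)) (tuplePlan lam Q) := by
  classical
  have hmem : ∀ q ∈ Q.support, ∀ i, q i ∈ (P i).support := fun q hq i =>
    mem_support_of_mapDomain_eq hQ (hmarg i) hq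
  refine ⟨fun i x k => ?_, fun i x k h => ?_, fun i x => ?_, fun i k => ?_⟩
  · rw [tuplePlan_apply]
    refine Finset.sum_nonneg fun q _ => ?_
    split_ifs
    exacts [hQ q, le_rfl, le_rfl]
  · rw [tuplePlan_apply] at h
    obtain ⟨q, hq, hne⟩ := Finset.exists_ne_zero_of_sum_ne_zero h
    split_ifs at hne with h1 h2
    · exact ⟨h1 ▸ mem_support_mapDomain _ hQ hq, h2 ▸ hmem q hq i⟩
    · exact absurd rfl hne
    · exact absurd rfl hne
  · simp only [tuplePlan_apply]
    rw [Finset.sum_comm, mapDomain_apply_eq_sum]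
    refine Finset.sum_congr rfl fun q hq => ?_
    split_ifs
    · simp [hmem q hq i]
    · simp
  · simp only [tuplePlan_apply]
    rw [Finset.sum_comm, ← hmarg i, mapDomain_apply_eq_sum]
    refine Finset.sum_congr rfl fun q hq => ?_
    rw [Finset.sum_ite_eq, if_pos (mem_support_mapDomain _ hQ hq)]

/-- If different tuples have different centroids, no mass is split. -/
theorem tuplePlan_nonMassSplitting (hQ : ∀ q, 0 ≤ Q q)
    (hmarg : ∀ i, Q.mapDomain (fun q => q i) = P i)
    (hinj : Set.InjOn (centroid lam) (Q.support : Set (Fin N → Pt d))) :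
    NonMassSplitting P (Q.mapDomain (centroid lam)) (tuplePlan lam Q) := by
  classical
  intro x hx i
  obtain ⟨q, hq, rfl⟩ := exists_of_mem_support_mapDomain hx
  have huniq : ∀ f : (Fin N → Pt d) → ℝ, (∑ q' ∈ Q.support,
      if centroid lam q' = centroid lam q then f q' else 0) = f q := by
    intro f
    rw [Finset.sum_eq_single_of_mem q hq, if_pos rfl]
    intro q' hq' hne
    exact if_neg fun h => hne (hinj hq' hq h)
  refine ⟨q i, mem_support_of_mapDomain_eq hQ (hmarg i) hq, ?_, fun k' hk' => ?_⟩
  · rw [tuplePlan_apply, mapDomain_apply_eq_sum, huniq, huniq, if_pos rfl]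
  · rw [tuplePlan_apply, huniq, if_neg hk'.symm]

theorem cost_tuplePlan (hQ : ∀ q, 0 ≤ Q q) (hmarg : ∀ i, Q.mapDomain (fun q => q i) = P i) :
    cost lam P (Q.mapDomain (centroid lam)) (tuplePlan lam Q) =
      Q.sum fun q a => a * ∑ i, lam i * ‖centroid lam q - q i‖ ^ 2 := by
  classical
  have hmem : ∀ q ∈ Q.support, ∀ i, q i ∈ (P i).support := fun q hq i =>
    mem_support_of_mapDomain_eq hQ (hmarg i) hq
  have hinner : ∀ i, ∑ x ∈ (Q.mapDomain (centroid lam)).support, ∑ k ∈ (P i).support,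
      ‖x - k‖ ^ 2 * tuplePlan lam Q i x k =
        ∑ q ∈ Q.support, ‖centroid lam q - q i‖ ^ 2 * Q q := by
    intro i
    simp only [tuplePlan_apply, Finset.mul_sum, mul_ite, mul_zero]
    rw [Finset.sum_congr rfl fun x _ => Finset.sum_comm, Finset.sum_comm]
    refine Finset.sum_congr rfl fun q hq => ?_
    rw [Finset.sum_eq_single_of_mem _ (mem_support_mapDomain (centroid lam) hQ hq),
      Finset.sum_eq_single_of_mem _ (hmem q hq i), if_pos rfl, if_pos rfl]
    · intro k _ hk
      rw [if_pos rfl, if_neg hk.symm]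
    · intro x _ hx
      simp [hx.symm]
  rw [cost, Finset.sum_congr rfl fun i _ => by rw [hinner i], Finsupp.sum]
  simp only [Finset.mul_sum]
  rw [Finset.sum_comm]
  exact Finset.sum_congr rfl fun q _ => Finset.sum_congr rfl fun i _ => by ring

/-- A measure on tuples has the total mass of each of its images, in particular of its
marginals. -/
theorem isDiscreteProb_mapDomain {α : Type*} {f : α → Pt d} {Q : α →₀ ℝ} (hQ : ∀ q, 0 ≤ Q q)
    {g : α → Pt d} {p : Mass d} (hp : IsDiscreteProb p) (hg : Q.mapDomain g = p) :
    IsDiscreteProb (Q.mapDomain f) := by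
  have htot : ∀ f : α → Pt d, ∑ x ∈ (Q.mapDomain f).support, Q.mapDomain f x =
      Q.sum fun _ a => a := fun f =>
    Finsupp.sum_mapDomain_index (h := fun _ a => a) (fun _ => rfl) fun _ _ _ => rfl
  refine ⟨mapDomain_nonneg f hQ, ?_⟩
  rw [htot, ← htot g, hg, hp.total]

end TuplePlan

/-! ### The outcome of the algorithm -/

/-- What a complete run returns, in terms of a measure on tuples. -/
theorem exists_tuples_of_spreadInv {lam : Fin N → ℝ} (hlam : ∑ i, lam i = 1) (hN : 0 < N)
    {P : Fin N → Mass d} {s : Fin r → Pt d} {C : ℝ} {σ₀ σ : State d N r}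
    (h₀ : ShiftInv lam P s C (shiftList r) σ₀) (h : SpreadInv lam P σ₀ [] σ) :
    ∃ Q : (Fin N → Pt d) →₀ ℝ, (∀ q, 0 ≤ Q q) ∧ (∀ i, Q.mapDomain (fun q => q i) = P i) ∧
      ∑ l, σ.out l = Q.mapDomain (centroid lam) ∧
      Set.InjOn (centroid lam) (Q.support : Set (Fin N → Pt d)) ∧
      (Q.sum fun q a => a * ∑ i, lam i * ‖centroid lam q - q i‖ ^ 2) ≤ C ∧
      Q.support.card + r * N ≤ r * (∑ i, (P i).support.card + 1) := by
  classical
  obtain ⟨G, hG⟩ := h.spread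
  have hzero : ∀ l i, σ.part l i = 0 := fun l i =>
    h.balanced.part_eq_zero ((h.done l).resolve_left (by simp)) i
  have hmarg : ∀ l i, (G l).mapDomain (fun q => q i) = σ₀.part l i := fun l i => by
    rw [← (hG l).split i, hzero, zero_add]
  have hmem : ∀ l, ∀ q ∈ (G l).support, ∀ i, q i ∈ (σ₀.part l i).support := fun l q hq i =>
    mem_support_of_mapDomain_eq (hG l).nonneg (hmarg l i) hq
  have hsupp : ∀ q ∈ (∑ l, G l).support, ∃ l, q ∈ (G l).support := by
    intro q hq
    rw [Finsupp.mem_support_iff, Finsupp.finsetSum_apply] at hq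
    obtain ⟨l, _, hl⟩ := Finset.exists_ne_zero_of_sum_ne_zero hq
    exact ⟨l, Finsupp.mem_support_iff.2 hl⟩
  refine ⟨∑ l, G l, fun q => ?_, fun i => ?_, ?_, ?_, ?_, ?_⟩
  · rw [Finsupp.finsetSum_apply]
    exact Finset.sum_nonneg fun l _ => (hG l).nonneg q
  · rw [Finsupp.mapDomain_finsetSum, ← h₀.cheapest.1.col i]
    exact Finset.sum_congr rfl fun l _ => hmarg l i
  · rw [Finsupp.mapDomain_finsetSum]
    exact Finset.sum_congr rfl fun l _ => (hG l).out_eq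
  · intro q hq q' hq' heq
    obtain ⟨l, hl⟩ := hsupp q hq
    obtain ⟨j, hj⟩ := hsupp q' hq'
    by_cases hlj : l = j
    · subst hlj
      exact (hG l).injOn hl hj heq
    · exact absurd heq (h₀.centroid_ne hlam hN hlj (hmem l q hl) (hmem j q' hj))
  · rw [← Finsupp.sum_finsetSum_index (by simp) (by intros; ring), ← h₀.cost_eq, partCost]
    refine Finset.sum_le_sum fun l _ => ?_
    have hrhs : ∀ i, ∑ k ∈ (P i).support, ‖s l - k‖ ^ 2 * σ₀.part l i k =
        ∑ q ∈ (G l).support, ‖s l - q i‖ ^ 2 * G l q := by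
      intro i
      simp only [← hmarg l i, mapDomain_apply_eq_sum, Finset.mul_sum, mul_ite, mul_zero]
      rw [Finset.sum_comm]
      refine Finset.sum_congr rfl fun q hq => ?_
      rw [Finset.sum_ite_eq, if_pos (h₀.cheapest.1.support_subset l i (hmem l q hq i))]
    simp only [hrhs, Finset.mul_sum, Finsupp.sum]
    rw [Finset.sum_comm (s := Finset.univ)]
    refine Finset.sum_le_sum fun q _ => ?_
    have := mul_le_mul_of_nonneg_left (sum_sq_dist_centroid_le hlam q (s l)) ((hG l).nonneg q)
    simp only [Finset.mul_sum] at this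
    refine this.trans_eq (Finset.sum_congr rfl fun i _ => by ring)
  · have hcard : (∑ l, G l).support.card ≤ ∑ l, (G l).support.card := by
      refine (Finset.card_le_card fun q hq => ?_).trans Finset.card_biUnion_le
      obtain ⟨l, hl⟩ := hsupp q hq
      exact Finset.mem_biUnion.2 ⟨l, Finset.mem_univ _, hl⟩
    have hsum : ∑ l, ((G l).support.card + N) ≤ ∑ _l : Fin r, (∑ i, (P i).support.card + 1) :=
      Finset.sum_le_sum fun l _ => (hG l).card_le
    rw [Finset.sum_add_distrib] at hsum
    simp only [Finset.sum_const, Finset.card_univ, Fintype.card_fin, smul_eq_mul] at hsum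
    exact (Nat.add_le_add_right hcard _).trans hsum

/-! ### The linear program -/

theorem sum_support_eq {s : Fin r → Pt d} (hs : Function.Injective s) {p : Mass d}
    (hp : ∀ x ∈ p.support, x ∈ Set.range s) {f : Pt d → ℝ} (hf : ∀ x, p x = 0 → f x = 0) :
    ∑ x ∈ p.support, f x = ∑ l, f (s l) := by
  classical
  rw [← Finset.sum_image (f := f) (s := Finset.univ) (g := s) fun a _ b _ h => hs h]
  refine Finset.sum_subset (fun x hx => ?_) fun x _ hx => hf x (Finsupp.notMem_support_iff.1 hx)
  obtain ⟨l, rfl⟩ := hp x hx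
  exact Finset.mem_image_of_mem _ (Finset.mem_univ l)

theorem IsTransport.eq_zero {P : Fin N → Mass d} {p : Mass d} {y : Plan d N}
    (hy : IsTransport P p y) {x : Pt d} (hx : p x = 0) (i : Fin N) : y i x = 0 := by
  ext k
  by_contra h
  exact Finsupp.mem_support_iff.1 (hy.supp i x k h).1 hx

theorem IsTransport.feasible_state {P : Fin N → Mass d} {p : Mass d} {y : Plan d N}
    (hy : IsTransport P p y) {s : Fin r → Pt d} (hs : Function.Injective s)
    (hp : ∀ x ∈ p.support, x ∈ Set.range s) : Feasible P (initial p y s).2 where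
  nonneg _ _ _ := hy.nonneg _ _ _
  supp _ _ _ h := (hy.supp _ _ _ h).2
  total _ _ := hy.row _ _
  col i := by
    ext k
    rw [Finsupp.finsetSum_apply, ← hy.col i k]
    exact (sum_support_eq hs hp (f := fun x => y i x k)
      fun x hx => by simp [hy.eq_zero hx]).symm

theorem IsTransport.cost_eq_partCost {P : Fin N → Mass d} {p : Mass d} {y : Plan d N}
    (hy : IsTransport P p y) {s : Fin r → Pt d} (hs : Function.Injective s)
    (hp : ∀ x ∈ p.support, x ∈ Set.range s) (lam : Fin N → ℝ) :
    cost lam P p y = partCost lam P s fun l i => y i (s l) := by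
  rw [cost, partCost, Finset.sum_comm]
  refine Finset.sum_congr rfl fun i _ => ?_
  rw [← Finset.mul_sum]
  congr 1
  exact sum_support_eq hs hp (f := fun x => ∑ k ∈ (P i).support, ‖x - k‖ ^ 2 * y i x k)
    fun x hx => by simp [hy.eq_zero hx]

/-- A feasible state gives a point of the linear program. -/
theorem Feasible.exists_isTransport {P : Fin N → Mass d} {σ : State d N r}
    (hσ : Feasible P σ) {s : Fin r → Pt d} (hs : Function.Injective s) :
    ∃ (p : Mass d) (y : Plan d N), IsTransport P p y ∧ (∀ x ∈ p.support, x ∈ Set.range s) ∧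
      ∀ l i, y i (s l) = σ.part l i := by
  classical
  have hmem : ∀ x, Function.extend s σ.mass 0 x ≠ 0 → x ∈ Finset.univ.image s := by
    intro x hx
    by_contra h
    refine hx (Function.extend_apply' _ _ _ fun ⟨l, hl⟩ => h ?_)
    exact hl ▸ Finset.mem_image_of_mem _ (Finset.mem_univ l)
  let p : Mass d := Finsupp.onFinset (Finset.univ.image s) (Function.extend s σ.mass 0) hmem
  let y : Plan d N := fun i x => Function.extend s (fun l => σ.part l i) 0 x
  have hps : ∀ l, p (s l) = σ.mass l := fun l => hs.extend_apply _ _ _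
  have hys : ∀ l i, y i (s l) = σ.part l i := fun l i => hs.extend_apply _ _ _
  have hy0 : ∀ i x, x ∉ Set.range s → y i x = 0 := fun i x hx =>
    Function.extend_apply' _ _ _ hx
  have hp0 : ∀ x, x ∉ Set.range s → p x = 0 := fun x hx => Function.extend_apply' _ _ _ hx
  have hrange : ∀ x ∈ p.support, x ∈ Set.range s := fun x hx => by
    by_contra h
    exact Finsupp.mem_support_iff.1 hx (hp0 x h)
  have hzero : ∀ x, p x = 0 → ∀ i, y i x = 0 := by
    intro x hx i
    by_cases h : x ∈ Set.range s
    · obtain ⟨l, rfl⟩ := h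
      rw [hps] at hx
      rw [hys, hσ.part_eq_zero hx.le]
    · exact hy0 i x h
  refine ⟨p, y, ⟨fun i x k => ?_, fun i x k h => ⟨?_, ?_⟩, fun i x => ?_, fun i k => ?_⟩, hrange,
    hys⟩
  · by_cases h : x ∈ Set.range s
    · obtain ⟨l, rfl⟩ := h
      rw [hys]
      exact hσ.nonneg l i k
    · simp [hy0 i x h]
  · rw [Finsupp.mem_support_iff]
    intro hx
    exact h (by simp [hzero x hx])
  · by_cases hx : x ∈ Set.range s
    · obtain ⟨l, rfl⟩ := hx
      rw [hys] at h
      exact hσ.supp l i k h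
    · exact absurd (by simp [hy0 i x hx]) h
  · by_cases h : x ∈ Set.range s
    · obtain ⟨l, rfl⟩ := h
      rw [hys, hps, hσ.total]
    · simp [hy0 i x h, hp0 x h]
  · rw [sum_support_eq hs hrange (f := fun x => y i x k) fun x hx => by simp [hzero x hx]]
    simp only [hys]
    rw [← hσ.col i, Finsupp.finsetSum_apply]

/-- The algorithm starts in a cheapest transport. -/
theorem shiftInv_initial {lam : Fin N → ℝ} {P : Fin N → Mass d} {S₀ : Set (Pt d)}
    {z : Mass d} {y : Plan d N} (hzy : IsOptimalVertex lam P S₀ (z, y)) {s : Fin r → Pt d}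
    (hs : Function.Injective s) (hrange : Set.range s = (z.support : Set (Pt d))) :
    ShiftInv lam P s (cost lam P z y) [] (initial z y s).2 := by
  have hy : IsTransport P z y := hzy.1.1.2
  have hz : ∀ x ∈ z.support, x ∈ Set.range s := fun x hx => hrange ▸ hx
  have hcost := hy.cost_eq_partCost hs hz lam
  refine ⟨⟨hy.feasible_state hs hz, fun σ' hσ' => ?_⟩, hcost.symm, fun _ => rfl, by simp⟩
  obtain ⟨p, y', hy', hp, hys⟩ := hσ'.exists_isTransport hs
  have hle := hzy.2 (p, y') ⟨fun x hx => hzy.1.1.1 x ?_, hy'⟩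
  · simp only at hle
    rw [hcost, hy'.cost_eq_partCost hs hp] at hle
    simp only [hys] at hle
    exact hle
  · have := hp x hx
    rw [hrange] at this
    exact this

/-! ### Vertices have small support -/

/-- Rescaling the mass at each point `x` by the factor `1 + u x`. -/
noncomputable def rescale (u : Pt d → ℝ) (p : Mass d) : Mass d :=
  Finsupp.onFinset p.support (fun x => (1 + u x) * p x) fun _ hx =>
    Finsupp.mem_support_iff.2 (right_ne_zero_of_mul hx)

theorem rescale_apply (u : Pt d → ℝ) (p : Mass d) (x : Pt d) :
    rescale u p x = (1 + u x) * p x := rfl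

theorem rescale_mem_feasible {P : Fin N → Mass d} {S₀ : Set (Pt d)} {z : Mass d} {y : Plan d N}
    (h : (z, y) ∈ feasible P S₀) {u : Pt d → ℝ} (hu : ∀ x, |u x| < 1)
    (hcol : ∀ i k, ∑ x ∈ z.support, u x * y i x k = 0) :
    (rescale u z, fun i x => (1 + u x) • y i x) ∈ feasible P S₀ := by
  obtain ⟨hS, hy⟩ := h
  simp only at hS hy
  have hpos : ∀ x, 0 < 1 + u x := fun x => by linarith [(abs_lt.1 (hu x)).1]
  have hsupp : (rescale u z).support = z.support := by
    ext x
    simp [rescale_apply, (hpos x).ne']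
  refine ⟨fun x hx => hS x (hsupp ▸ hx), ⟨fun i x k => ?_, fun i x k hne => ?_, fun i x => ?_,
    fun i k => ?_⟩⟩
  · exact mul_nonneg (hpos x).le (hy.nonneg i x k)
  · rw [hsupp]
    exact hy.supp i x k (right_ne_zero_of_mul hne)
  · simp only [Finsupp.smul_apply, smul_eq_mul, ← Finset.mul_sum, hy.row, rescale_apply]
  · simp only [Finsupp.smul_apply, smul_eq_mul, hsupp, add_mul, one_mul, Finset.sum_add_distrib,
      hy.col, hcol, add_zero]

theorem eq_zero_of_mem_extremePoints {P : Fin N → Mass d} {S₀ : Set (Pt d)} {z : Mass d}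
    {y : Plan d N} (h : (z, y) ∈ (feasible P S₀).extremePoints ℝ) {u : Pt d → ℝ}
    (hu : ∀ x, |u x| < 1) (hcol : ∀ i k, ∑ x ∈ z.support, u x * y i x k = 0) {x : Pt d}
    (hx : x ∈ z.support) : u x = 0 := by
  have h1 := rescale_mem_feasible h.1 hu hcol
  have h2 := rescale_mem_feasible h.1 (u := fun x => -u x) (fun x => by rw [abs_neg]; exact hu x)
    fun i k => by simp only [neg_mul, Finset.sum_neg_distrib, hcol, neg_zero]
  -- The vertex is the midpoint of its rescalings by `1 + u` and `1 - u`.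
  have hseg : (z, y) ∈ openSegment ℝ (rescale u z, fun i x => (1 + u x) • y i x)
      (rescale (fun x => -u x) z, fun i x => (1 + -u x) • y i x) := by
    refine ⟨1 / 2, 1 / 2, by norm_num, by norm_num, by norm_num, Prod.ext ?_ ?_⟩
    · ext x
      simp only [Prod.fst_add, Prod.smul_fst, Finsupp.add_apply, Finsupp.smul_apply, smul_eq_mul,
        rescale_apply]
      ring
    · funext i x
      ext k
      simp only [Prod.snd_add, Prod.smul_snd, Pi.add_apply, Pi.smul_apply, Finsupp.add_apply,
        Finsupp.smul_apply, smul_eq_mul]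
      ring
  have heq := congrArg (fun zy : Mass d × Plan d N => zy.1 x) (h.2 h1 h2 hseg)
  simp only [rescale_apply] at heq
  have hzx := Finsupp.mem_support_iff.1 hx
  have : u x * z x = 0 := by linarith
  exact (mul_eq_zero.1 this).resolve_right hzx

/-- The mass of a vertex sits in at most `∑ i, |P i| - N + 1` points. Otherwise the masses at the
points could be rescaled nontrivially without changing the marginals: these are `∑ i, |P i|` linear
conditions, `N - 1` of which are redundant since all marginals have the same total. -/
theorem card_add_le_of_mem_extremePoints {P : Fin N → Mass d}
    (hP : ∀ i, (P i).support.Nonempty) {S₀ : Set (Pt d)} {z : Mass d} {y : Plan d N}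
    (h : (z, y) ∈ (feasible P S₀).extremePoints ℝ) {s : Fin r → Pt d}
    (hs : Function.Injective s) (hrange : Set.range s = (z.support : Set (Pt d))) :
    r + N ≤ ∑ i, (P i).support.card + 1 := by
  classical
  have hy : IsTransport P z y := h.1.2
  have hz : ∀ x ∈ z.support, x ∈ Set.range s := fun x hx => hrange ▸ hx
  choose k₀ hk₀ using hP
  -- The total mass and the masses at all points but one of each marginal determine the marginals.
  let T : (Fin r → ℝ) →ₗ[ℝ] ℝ × ((Σ i, ((P i).support.erase (k₀ i) : Finset (Pt d))) → ℝ) :=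
    { toFun := fun w => (∑ l, w l * z (s l), fun ik => ∑ l, w l * y ik.1 (s l) ik.2)
      map_add' := fun v w => by
        refine Prod.ext ?_ (funext fun ik => ?_) <;>
          simp [add_mul, Finset.sum_add_distrib]
      map_smul' := fun a w => by
        refine Prod.ext ?_ (funext fun ik => ?_) <;>
          simp [Finset.mul_sum, mul_assoc] }
  have hT : Function.Injective T := by
    rw [← LinearMap.ker_eq_bot, LinearMap.ker_eq_bot']
    intro w hw
    have hw1 : ∑ l, w l * z (s l) = 0 := congrArg Prod.fst hw
    have hw2 : ∀ i, ∀ k ∈ (P i).support, k ≠ k₀ i → ∑ l, w l * y i (s l) k = 0 :=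
      fun i k hk hne => congrFun (congrArg Prod.snd hw) ⟨i, k, Finset.mem_erase.2 ⟨hne, hk⟩⟩
    have hw3 : ∀ i k, ∑ l, w l * y i (s l) k = 0 := by
      intro i k
      by_cases hk : k ∈ (P i).support
      · by_cases hne : k = k₀ i
        · subst hne
          have htot : ∑ k ∈ (P i).support, ∑ l, w l * y i (s l) k = 0 := by
            rw [Finset.sum_comm, ← hw1]
            exact Finset.sum_congr rfl fun l _ => by rw [← Finset.mul_sum, hy.row]
          rwa [Finset.sum_eq_single_of_mem (k₀ i) hk fun k hk hne => hw2 i k hk hne] at htot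
        · exact hw2 i k hk hne
      · refine Finset.sum_eq_zero fun l _ => ?_
        have : y i (s l) k = 0 := by
          by_contra hne
          exact hk (hy.supp i _ k hne).2
        rw [this, mul_zero]
    -- Scaled down, `w` is an admissible rescaling.
    have hε : 0 < (1 + ‖w‖)⁻¹ := by positivity
    let u : Pt d → ℝ := Function.extend s (fun l => (1 + ‖w‖)⁻¹ * w l) 0
    have hus : ∀ l, u (s l) = (1 + ‖w‖)⁻¹ * w l := fun l => hs.extend_apply _ _ _
    have hu : ∀ x, |u x| < 1 := by
      intro x
      by_cases hx : x ∈ Set.range s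
      · obtain ⟨l, rfl⟩ := hx
        rw [hus, abs_mul, abs_of_pos hε, inv_mul_lt_iff₀ (by positivity), mul_one]
        have := norm_le_pi_norm w l
        rw [Real.norm_eq_abs] at this
        linarith
      · have : u x = 0 := Function.extend_apply' _ _ _ hx
        simp [this]
    have hcol : ∀ i k, ∑ x ∈ z.support, u x * y i x k = 0 := by
      intro i k
      rw [sum_support_eq hs hz (f := fun x => u x * y i x k)
        fun x hx => by simp [hy.eq_zero hx]]
      simp only [hus, mul_assoc, ← Finset.mul_sum, hw3, mul_zero]
    funext l
    have hl : s l ∈ z.support := by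
      have : s l ∈ Set.range s := ⟨l, rfl⟩
      rw [hrange] at this
      exact this
    have := eq_zero_of_mem_extremePoints h hu hcol hl
    rw [hus] at this
    exact (mul_eq_zero.1 this).resolve_left hε.ne'
  have hfin := LinearMap.finrank_le_finrank_of_injective hT
  rw [Module.finrank_prod, Module.finrank_self, Module.finrank_fintype_fun_eq_card,
    Module.finrank_fintype_fun_eq_card, Fintype.card_fin, Fintype.card_sigma] at hfin
  simp only [Fintype.card_coe] at hfin
  have hcard : ∑ i, ((P i).support.erase (k₀ i)).card + N = ∑ i, (P i).support.card := by
    have : ∀ i, ((P i).support.erase (k₀ i)).card + 1 = (P i).support.card := fun i =>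
      Finset.card_erase_add_one (hk₀ i)
    rw [← Finset.sum_congr rfl fun i _ => this i, Finset.sum_add_distrib]
    simp
  omega

/-! ### Couplings -/

theorem W2_sq (μ ν : Measure (Pt d)) :
    W2 μ ν ^ 2 = ⨅ π ∈ couplings μ ν, ∫⁻ q, ‖q.1 - q.2‖ₑ ^ 2 ∂π := by
  rw [W2, ← ENNReal.rpow_natCast, ← ENNReal.rpow_mul]
  norm_num

theorem toMeasure_apply (p : Mass d) {A : Set (Pt d)} (hA : MeasurableSet A) :
    toMeasure p A = ∑ x ∈ p.support, ENNReal.ofReal (p x) * A.indicator 1 x := by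
  rw [toMeasure, Measure.finsetSum_apply]
  exact Finset.sum_congr rfl fun x _ => by
    rw [Measure.smul_apply, Measure.dirac_apply' _ hA, smul_eq_mul]

/-- A transport is a coupling, so it bounds the Wasserstein distances. -/
theorem phi_toMeasure_le {lam : Fin N → ℝ} (hlam_pos : ∀ i, 0 < lam i) {P : Fin N → Mass d}
    {p : Mass d} {y : Plan d N} (hy : IsTransport P p y) :
    phi lam P (toMeasure p) ≤ ENNReal.ofReal (cost lam P p y) := by
  have hterm : ∀ i x k, 0 ≤ ‖x - k‖ ^ 2 * y i x k := fun i x k =>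
    mul_nonneg (sq_nonneg _) (hy.nonneg i x k)
  rw [phi, cost, ENNReal.ofReal_sum_of_nonneg fun i _ => mul_nonneg (hlam_pos i).le
    (Finset.sum_nonneg fun x _ => Finset.sum_nonneg fun k _ => hterm i x k)]
  refine Finset.sum_le_sum fun i _ => ?_
  rw [ENNReal.ofReal_mul (hlam_pos i).le]
  refine mul_le_mul_right ?_ _
  let π : Measure (Pt d × Pt d) := ∑ x ∈ p.support, ∑ k ∈ (P i).support,
    ENNReal.ofReal (y i x k) • Measure.dirac (x, k)
  have hπ_apply : ∀ B : Set (Pt d × Pt d), MeasurableSet B → π B =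
      ∑ x ∈ p.support, ∑ k ∈ (P i).support, ENNReal.ofReal (y i x k) * B.indicator 1 (x, k) := by
    intro B hB
    simp only [π, Measure.finsetSum_apply, Measure.smul_apply, Measure.dirac_apply' _ hB,
      smul_eq_mul]
  have hπ : π ∈ couplings (toMeasure p) (toMeasure (P i)) := by
    constructor
    · ext A hA
      rw [Measure.map_apply measurable_fst hA, hπ_apply _ (measurable_fst hA),
        toMeasure_apply _ hA]
      refine Finset.sum_congr rfl fun x _ => ?_
      rw [← hy.row i x, ENNReal.ofReal_sum_of_nonneg fun k _ => hy.nonneg i x k, Finset.sum_mul]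
      rfl
    · ext A hA
      rw [Measure.map_apply measurable_snd hA, hπ_apply _ (measurable_snd hA),
        toMeasure_apply _ hA, Finset.sum_comm]
      refine Finset.sum_congr rfl fun k _ => ?_
      rw [← hy.col i k, ENNReal.ofReal_sum_of_nonneg fun x _ => hy.nonneg i x k, Finset.sum_mul]
      rfl
  rw [W2_sq]
  refine (iInf₂_le π hπ).trans_eq ?_
  rw [ENNReal.ofReal_sum_of_nonneg fun x _ => Finset.sum_nonneg fun k _ => hterm i x k]
  simp only [π, lintegral_finsetSum_measure, lintegral_smul_measure, lintegral_dirac, smul_eq_mul]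
  refine Finset.sum_congr rfl fun x _ => ?_
  rw [ENNReal.ofReal_sum_of_nonneg fun k _ => hterm i x k]
  refine Finset.sum_congr rfl fun k _ => ?_
  rw [ENNReal.ofReal_mul (sq_nonneg _), ENNReal.ofReal_pow (norm_nonneg _), ofReal_norm, mul_comm]

/-! ### The approximation ratio -/

/-- The mean squared distance of two independent samples is at most twice the mean squared
distance of a sample to any given point. The weights `v` may be signed. -/
theorem sum_sum_sq_dist_le {ι : Type*} (s : Finset ι) {v : ι → ℝ} (hv : ∑ a ∈ s, v a = 1)
    (p : ι → Pt d) (x : Pt d) :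
    ∑ a ∈ s, ∑ b ∈ s, v a * v b * ‖p a - p b‖ ^ 2 ≤ 2 * ∑ a ∈ s, v a * ‖x - p a‖ ^ 2 := by
  have hinner : ∑ a ∈ s, ∑ b ∈ s, v a * v b * inner ℝ (x - p a) (x - p b) =
      ‖∑ a ∈ s, v a • (x - p a)‖ ^ 2 := by
    rw [← real_inner_self_eq_norm_sq, sum_inner]
    refine Finset.sum_congr rfl fun a _ => ?_
    rw [inner_sum]
    refine Finset.sum_congr rfl fun b _ => ?_
    rw [inner_smul_left, inner_smul_right]
    simp [mul_assoc]
  have hexp : ∀ a b, v a * v b * ‖p a - p b‖ ^ 2 = v a * ‖x - p a‖ ^ 2 * v b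
      + v a * (v b * ‖x - p b‖ ^ 2) - 2 * (v a * v b * inner ℝ (x - p a) (x - p b)) := by
    intro a b
    have : p a - p b = (x - p b) - (x - p a) := by abel
    rw [this, norm_sub_sq_real, real_inner_comm]
    ring
  simp only [hexp, Finset.sum_sub_distrib, Finset.sum_add_distrib, ← Finset.mul_sum,
    ← Finset.sum_mul, hv, hinner]
  linarith [sq_nonneg ‖∑ a ∈ s, v a • (x - p a)‖]

/-- Disintegration of a coupling with a discrete measure `p`: the point `x` sends the fraction
`a k x` of its mass to the support point `k` of `p`. -/
theorem exists_weights_of_mem_couplings {μ : Measure (Pt d)} [IsProbabilityMeasure μ] {p : Mass d}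
    (hp : IsDiscreteProb p) {π : Measure (Pt d × Pt d)} (hπ : π ∈ couplings μ (toMeasure p)) :
    ∃ a : Pt d → Pt d → ℝ, (∀ k, Measurable (a k)) ∧ (∀ k x, 0 ≤ a k x) ∧ (∀ k x, a k x ≤ 1) ∧
      (∀ k, k ∉ p.support → ∀ x, a k x = 0) ∧ (∀ᵐ x ∂μ, ∑ k ∈ p.support, a k x = 1) ∧
      (∀ k, ∫ x, a k x ∂μ = p k) ∧
      ∫⁻ x, ENNReal.ofReal (∑ k ∈ p.support, ‖x - k‖ ^ 2 * a k x) ∂μ ≤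
        ∫⁻ q, ‖q.1 - q.2‖ₑ ^ 2 ∂π := by
  classical
  have hprob : IsProbabilityMeasure π := ⟨by
    have h := congrArg (fun ν : Measure (Pt d) => ν Set.univ) hπ.1
    simp only [Measure.map_apply measurable_fst MeasurableSet.univ, Set.preimage_univ,
      measure_univ] at h
    exact h⟩
  have hfst : π.fst = μ := hπ.1
  let κ := π.condKernel
  have hκ : ∀ B : Set (Pt d), MeasurableSet B → ∫⁻ x, κ x B ∂μ = toMeasure p B := by
    intro B hB
    rw [← hπ.2, Measure.map_apply measurable_snd hB, ← hfst,
      ← lintegral_indicator_one (measurable_snd hB),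
      ← Measure.lintegral_condKernel (f := (Prod.snd ⁻¹' B).indicator 1)
        (measurable_one.indicator (measurable_snd hB))]
    refine lintegral_congr fun x => ?_
    rw [← lintegral_indicator_one hB]
    rfl
  have hle1 : ∀ k x, (κ x).real {k} ≤ 1 := fun k x => measureReal_le_one
  have hmeas : ∀ k, Measurable fun x => (κ x).real {k} := fun k =>
    (ProbabilityTheory.Kernel.measurable_coe κ (measurableSet_singleton k)).ennreal_toReal
  refine ⟨fun k x => if k ∈ p.support then (κ x).real {k} else 0, fun k => ?_, fun k x => ?_,
    fun k x => ?_, fun k hk x => if_neg hk, ?_, fun k => ?_, ?_⟩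
  · by_cases hk : k ∈ p.support
    · simpa only [if_pos hk] using hmeas k
    · simp only [if_neg hk, measurable_const]
  · beta_reduce
    split_ifs
    exacts [measureReal_nonneg, le_rfl]
  · beta_reduce
    split_ifs
    exacts [hle1 k x, zero_le_one]
  · have hzero : ∫⁻ x, κ x (p.support : Set (Pt d))ᶜ ∂μ = 0 := by
      rw [hκ _ p.support.measurableSet.compl, toMeasure_apply _ p.support.measurableSet.compl]
      refine Finset.sum_eq_zero fun x hx => ?_
      rw [Set.indicator_of_notMem (by simpa using hx), mul_zero]
    rw [lintegral_eq_zero_iff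
      (ProbabilityTheory.Kernel.measurable_coe κ p.support.measurableSet.compl)] at hzero
    filter_upwards [hzero] with x hx
    have h1 : (κ x).real (p.support : Set (Pt d)) = 1 := by
      rw [measureReal_def, (prob_compl_eq_zero_iff p.support.measurableSet).1 hx]
      rfl
    rw [← h1, ← sum_measureReal_singleton]
    exact Finset.sum_congr rfl fun k hk => if_pos hk
  · by_cases hk : k ∈ p.support
    · simp only [if_pos hk]
      have h := hκ {k} (measurableSet_singleton k)
      rw [toMeasure_apply _ (measurableSet_singleton k), Finset.sum_eq_single_of_mem k hk
        fun x _ hx => by rw [Set.indicator_of_notMem (by simpa using hx), mul_zero]] at h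
      simp only [Set.mem_singleton_iff, Set.indicator_of_mem, Pi.one_apply, mul_one] at h
      simp only [measureReal_def]
      rw [integral_toReal (ProbabilityTheory.Kernel.measurable_coe κ
        (measurableSet_singleton k)).aemeasurable
        (Filter.Eventually.of_forall fun x => measure_lt_top _ _), h,
        ENNReal.toReal_ofReal (hp.nonneg k)]
    · simp [hk, Finsupp.notMem_support_iff.1 hk]
  · rw [← Measure.lintegral_condKernel (ρ := π) (f := fun q => ‖q.1 - q.2‖ₑ ^ 2) (by fun_prop),
      hfst]
    refine lintegral_mono fun x => ?_
    refine le_trans (le_of_eq ?_)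
      (setLIntegral_le_lintegral (p.support : Set (Pt d)) fun b => ‖x - b‖ₑ ^ 2)
    rw [lintegral_finset, ENNReal.ofReal_sum_of_nonneg]
    · refine Finset.sum_congr rfl fun k hk => ?_
      beta_reduce
      rw [if_pos hk, ENNReal.ofReal_mul (sq_nonneg _), ENNReal.ofReal_pow (norm_nonneg _),
        ofReal_norm, measureReal_def, ENNReal.ofReal_toReal (measure_ne_top _ _)]
    · intro k _
      refine mul_nonneg (sq_nonneg _) ?_
      beta_reduce
      split_ifs
      exact measureReal_nonneg

/-- The plan moving `P j` to every `P i` along `μ`: a support point of `P j` is coupled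
with one of `P i` when both receive mass from the same point of `μ`, independently. -/
noncomputable def gluedPlan (P : Fin N → Mass d) (μ : Measure (Pt d))
    (a : Fin N → Pt d → Pt d → ℝ) (ha : ∀ i k, k ∉ (P i).support → ∀ x, a i k x = 0)
    (j : Fin N) : Plan d N :=
  fun i k => Finsupp.onFinset (P i).support (fun k' => ∫ x, a j k x * a i k' x ∂μ) fun k' h => by
    by_contra hk'
    exact h (by simp [ha i k' hk'])

/-- The optimal value of the linear program is at most twice the value of any family of
couplings of a measure `μ` with the measures `P i`. -/
theorem cost_le_of_couplings {lam : Fin N → ℝ} (hlam_pos : ∀ i, 0 < lam i)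
    (hlam : ∑ i, lam i = 1) {P : Fin N → Mass d} (hP : ∀ i, IsDiscreteProb (P i)) {z : Mass d}
    {y : Plan d N} (hzy : IsOptimalVertex lam P (origSupport P) (z, y)) {μ : Measure (Pt d)}
    [IsProbabilityMeasure μ] {π : Fin N → Measure (Pt d × Pt d)}
    (hπ : ∀ i, π i ∈ couplings μ (toMeasure (P i))) :
    ENNReal.ofReal (cost lam P z y) ≤
      2 * ∑ i, ENNReal.ofReal (lam i) * ∫⁻ q, ‖q.1 - q.2‖ₑ ^ 2 ∂(π i) := by
  choose a hmeas hnonneg hle hzero hsum hint hcost using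
    fun i => exists_weights_of_mem_couplings (hP i) (hπ i)
  have hprod_int : ∀ i j k k', Integrable (fun x => a j k x * a i k' x) μ := by
    intro i j k k'
    refine Integrable.of_bound ((hmeas j k).mul (hmeas i k')).aestronglyMeasurable 1
      (Filter.Eventually.of_forall fun x => ?_)
    rw [Real.norm_eq_abs, abs_of_nonneg (mul_nonneg (hnonneg j k x) (hnonneg i k' x))]
    exact mul_le_one₀ (hle j k x) (hnonneg i k' x) (hle i k' x)
  have happ : ∀ i j k k', gluedPlan P μ a hzero j i k k' = ∫ x, a j k x * a i k' x ∂μ :=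
    fun _ _ _ _ => rfl
  have htrans : ∀ j, IsTransport P (P j) (gluedPlan P μ a hzero j) := by
    intro j
    refine ⟨fun i k k' => ?_, fun i k k' h => ⟨?_, ?_⟩, fun i k => ?_, fun i k' => ?_⟩
    · rw [happ]
      exact integral_nonneg fun x => mul_nonneg (hnonneg j k x) (hnonneg i k' x)
    · by_contra hk
      exact h (by simp [happ, hzero j k hk])
    · by_contra hk
      exact h (by simp [happ, hzero i k' hk])
    · simp only [happ]
      rw [← integral_finsetSum _ fun k' _ => hprod_int i j k k', ← hint j k]
      refine integral_congr_ae ?_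
      filter_upwards [hsum i] with x hx
      rw [← Finset.mul_sum, hx, mul_one]
    · simp only [happ]
      rw [← integral_finsetSum _ fun k _ => hprod_int i j k k', ← hint i k']
      refine integral_congr_ae ?_
      filter_upwards [hsum j] with x hx
      rw [← Finset.sum_mul, hx, one_mul]
  let F : Fin N → Pt d → ℝ := fun j x => ∑ i, lam i * ∑ k ∈ (P j).support,
    ∑ k' ∈ (P i).support, ‖k - k'‖ ^ 2 * (a j k x * a i k' x)
  have hF_int : ∀ j, Integrable (F j) μ := fun j =>
    integrable_finsetSum _ fun i _ => (integrable_finsetSum _ fun k _ =>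
      integrable_finsetSum _ fun k' _ => (hprod_int i j k k').const_mul _).const_mul _
  have hF_nonneg : ∀ j x, 0 ≤ F j x := fun j x =>
    Finset.sum_nonneg fun i _ => mul_nonneg (hlam_pos i).le <| Finset.sum_nonneg fun k _ =>
      Finset.sum_nonneg fun k' _ => mul_nonneg (sq_nonneg _)
        (mul_nonneg (hnonneg j k x) (hnonneg i k' x))
  have hle_F : ∀ j, cost lam P z y ≤ ∫ x, F j x ∂μ := by
    intro j
    have hopt := hzy.2 (P j, gluedPlan P μ a hzero j) ⟨fun x hx => ⟨j, hx⟩, htrans j⟩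
    refine hopt.trans_eq ?_
    simp only [cost, happ, F]
    rw [integral_finsetSum _ fun i _ => (integrable_finsetSum _ fun k _ =>
      integrable_finsetSum _ fun k' _ => (hprod_int i j k k').const_mul _).const_mul _]
    refine Finset.sum_congr rfl fun i _ => ?_
    rw [integral_const_mul, integral_finsetSum _ fun k _ =>
      integrable_finsetSum _ fun k' _ => (hprod_int i j k k').const_mul _]
    congr 1
    refine Finset.sum_congr rfl fun k _ => ?_
    rw [integral_finsetSum _ fun k' _ => (hprod_int i j k k').const_mul _]
    exact Finset.sum_congr rfl fun k' _ => (integral_const_mul _ _).symm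
  -- The bounds coming from the sources `P j` are averaged with the weights `lam j`.
  have hmean : cost lam P z y ≤ ∫ x, ∑ j, lam j * F j x ∂μ := by
    rw [integral_finsetSum _ fun j _ => (hF_int j).const_mul _]
    simp only [integral_const_mul]
    calc cost lam P z y = ∑ j, lam j * cost lam P z y := by rw [← Finset.sum_mul, hlam, one_mul]
      _ ≤ _ := Finset.sum_le_sum fun j _ => mul_le_mul_of_nonneg_left (hle_F j) (hlam_pos j).le
  have hpt : ∀ᵐ x ∂μ, ∑ j, lam j * F j x ≤
      2 * ∑ i, lam i * ∑ k ∈ (P i).support, ‖x - k‖ ^ 2 * a i k x := by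
    filter_upwards [ae_all_iff.2 hsum] with x hx
    have h := sum_sum_sq_dist_le (Finset.univ.sigma fun i : Fin N => (P i).support)
      (v := fun ik => lam ik.1 * a ik.1 ik.2 x) (p := fun ik => ik.2) (x := x)
      (by simp only [Finset.sum_sigma, ← Finset.mul_sum, hx, mul_one, hlam])
    simp only [Finset.sum_sigma] at h
    convert h using 1
    · refine Finset.sum_congr rfl fun j _ => ?_
      simp only [F, Finset.mul_sum]
      rw [Finset.sum_comm]
      refine Finset.sum_congr rfl fun k _ => Finset.sum_congr rfl fun i _ =>
        Finset.sum_congr rfl fun k' _ => by ring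
    · simp only [Finset.mul_sum]
      refine Finset.sum_congr rfl fun i _ => Finset.sum_congr rfl fun k _ => by ring
  have hterm_nonneg : ∀ i x, 0 ≤ ∑ k ∈ (P i).support, ‖x - k‖ ^ 2 * a i k x := fun i x =>
    Finset.sum_nonneg fun k _ => mul_nonneg (sq_nonneg _) (hnonneg i k x)
  have hterm_meas : ∀ i, Measurable fun x =>
      ENNReal.ofReal (∑ k ∈ (P i).support, ‖x - k‖ ^ 2 * a i k x) := fun i =>
    (Finset.measurable_sum _ fun k _ =>
      ((by fun_prop : Measurable fun x : Pt d => ‖x - k‖ ^ 2).mul (hmeas i k))).ennreal_ofReal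
  calc ENNReal.ofReal (cost lam P z y)
      ≤ ENNReal.ofReal (∫ x, ∑ j, lam j * F j x ∂μ) := ENNReal.ofReal_le_ofReal hmean
    _ = ∫⁻ x, ENNReal.ofReal (∑ j, lam j * F j x) ∂μ :=
        ofReal_integral_eq_lintegral_ofReal
          (integrable_finsetSum _ fun j _ => (hF_int j).const_mul _)
          (Filter.Eventually.of_forall fun x =>
            Finset.sum_nonneg fun j _ => mul_nonneg (hlam_pos j).le (hF_nonneg j x))
    _ ≤ ∫⁻ x, 2 * ∑ i, ENNReal.ofReal (lam i) *
          ENNReal.ofReal (∑ k ∈ (P i).support, ‖x - k‖ ^ 2 * a i k x) ∂μ := by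
        refine lintegral_mono_ae ?_
        filter_upwards [hpt] with x hx
        refine (ENNReal.ofReal_le_ofReal hx).trans_eq ?_
        rw [ENNReal.ofReal_mul zero_le_two, ENNReal.ofReal_ofNat,
          ENNReal.ofReal_sum_of_nonneg fun i _ => mul_nonneg (hlam_pos i).le (hterm_nonneg i x)]
        simp only [ENNReal.ofReal_mul (hlam_pos _).le]
    _ = 2 * ∑ i, ENNReal.ofReal (lam i) *
          ∫⁻ x, ENNReal.ofReal (∑ k ∈ (P i).support, ‖x - k‖ ^ 2 * a i k x) ∂μ := by
        rw [lintegral_const_mul _ (Finset.measurable_sum _ fun i _ =>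
          (hterm_meas i).const_mul _), lintegral_finsetSum _ fun i _ => (hterm_meas i).const_mul _]
        simp only [lintegral_const_mul _ (hterm_meas _)]
    _ ≤ _ := mul_le_mul_right (Finset.sum_le_sum fun i _ => mul_le_mul_right (hcost i) _) _

/-- The optimal value of the linear program is at most twice the value of `φ` at any probability
measure. -/
theorem cost_le_two_mul_phi {lam : Fin N → ℝ} (hlam_pos : ∀ i, 0 < lam i)
    (hlam : ∑ i, lam i = 1) {P : Fin N → Mass d} (hP : ∀ i, IsDiscreteProb (P i)) {z : Mass d}
    {y : Plan d N} (hzy : IsOptimalVertex lam P (origSupport P) (z, y)) (μ : Measure (Pt d))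
    [IsProbabilityMeasure μ] :
    ENNReal.ofReal (cost lam P z y) ≤ 2 * phi lam P μ := by
  refine ENNReal.le_of_forall_pos_le_add fun ε hε hfin => ?_
  have hW : ∀ i, W2 μ (toMeasure (P i)) ^ 2 ≠ ∞ := by
    intro i htop
    refine hfin.ne ?_
    rw [phi, ENNReal.sum_eq_top.2 ⟨i, Finset.mem_univ _, ?_⟩, ENNReal.mul_top (by norm_num)]
    rw [htop, ENNReal.mul_top (ENNReal.ofReal_pos.2 (hlam_pos i)).ne']
  have hε2 : ((ε : ℝ≥0∞) / 2) ≠ 0 := by simpa using hε.ne'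
  have hex : ∀ i, ∃ π ∈ couplings μ (toMeasure (P i)),
      ∫⁻ q, ‖q.1 - q.2‖ₑ ^ 2 ∂π < W2 μ (toMeasure (P i)) ^ 2 + ε / 2 := by
    intro i
    have h := ENNReal.lt_add_right (hW i) hε2
    nth_rewrite 1 [W2_sq] at h
    simpa only [iInf_lt_iff, exists_prop] using h
  choose π hπ hlt using hex
  refine (cost_le_of_couplings hlam_pos hlam hP hzy hπ).trans ?_
  calc 2 * ∑ i, ENNReal.ofReal (lam i) * ∫⁻ q, ‖q.1 - q.2‖ₑ ^ 2 ∂(π i)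
      ≤ 2 * ∑ i, ENNReal.ofReal (lam i) * (W2 μ (toMeasure (P i)) ^ 2 + ε / 2) :=
        mul_le_mul_right (Finset.sum_le_sum fun i _ => mul_le_mul_right (hlt i).le _) _
    _ = 2 * phi lam P μ + ε := by
        simp only [mul_add, Finset.sum_add_distrib, ← Finset.sum_mul, phi]
        rw [← ENNReal.ofReal_sum_of_nonneg fun i _ => (hlam_pos i).le, hlam, ENNReal.ofReal_one,
          one_mul, ENNReal.mul_div_cancel (by norm_num) (by norm_num)]

end WBary

theorem mainTheorem4 {d N : ℕ} (lam : Fin N → ℝ) (hlam_pos : ∀ i, 0 < lam i)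
    (hlam_sum : ∑ i, lam i = 1)
    (P : Fin N → WBary.Mass d) (hP : ∀ i, WBary.IsDiscreteProb (P i))
    (z : WBary.Mass d) (y : WBary.Plan d N)
    (hzy : WBary.IsOptimalVertex lam P (WBary.origSupport P) (z, y))
    {r : ℕ} (s : Fin r → WBary.Pt d) (hs_inj : Function.Injective s)
    (hs_range : Set.range s = (z.support : Set (WBary.Pt d))) :
    WBary.AlwaysReturns lam s (WBary.initial z y s) ∧
    ∀ P' : WBary.Mass d, WBary.Returns lam z y s P' →
      WBary.IsDiscreteProb P' ∧
      (P'.support : Set (WBary.Pt d)) ⊆ WBary.centroidSet lam P ∧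
      (∀ Pbar : MeasureTheory.Measure (WBary.Pt d), WBary.IsBarycenter lam P Pbar →
        WBary.phi lam P (WBary.toMeasure P') ≤ 2 * WBary.phi lam P Pbar) ∧
      (∃ y' : WBary.Plan d N, WBary.IsTransport P P' y' ∧ WBary.NonMassSplitting P P' y' ∧
        ∀ Pbar : MeasureTheory.Measure (WBary.Pt d), WBary.IsBarycenter lam P Pbar →
          ENNReal.ofReal (WBary.cost lam P P' y') ≤ 2 * WBary.phi lam P Pbar) ∧
      (P'.support.card : ℤ) ≤ (∑ i, ((P i).support.card : ℤ) - N + 1) ^ 2 := by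
  have hN : 0 < N := by
    rcases Nat.eq_zero_or_pos N with rfl | h
    · simp at hlam_sum
    · exact h
  have hne : ∀ i, (P i).support.Nonempty := by
    intro i
    by_contra h
    have := (hP i).total
    rw [Finset.not_nonempty_iff_eq_empty.1 h] at this
    simp at this
  have hinit := WBary.shiftInv_initial hzy hs_inj hs_range
  refine ⟨WBary.alwaysReturns_of_balanced hN hinit.cheapest.1.toBalanced
    WBary.shiftsDistinct_program, ?_⟩
  rintro P' ⟨σ, hreach, rfl⟩
  obtain ⟨σ₀, hσ₀, hσ⟩ :=
    WBary.exists_spreadInv_of_reaches hlam_pos hlam_sum hN hne hinit hreach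
  obtain ⟨Q, hQ, hmarg, hout, hinj, hcost, hcard⟩ :=
    WBary.exists_tuples_of_spreadInv hlam_sum hN hσ₀ hσ
  rw [hout]
  have htrans := WBary.tuplePlan_isTransport (lam := lam) hQ hmarg
  have hbound : ∀ Pbar : MeasureTheory.Measure (WBary.Pt d), WBary.IsBarycenter lam P Pbar →
      ENNReal.ofReal (WBary.cost lam P (Q.mapDomain (WBary.centroid lam))
        (WBary.tuplePlan lam Q)) ≤ 2 * WBary.phi lam P Pbar := by
    intro Pbar hPbar
    have := hPbar.1.1
    rw [WBary.cost_tuplePlan hQ hmarg]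
    exact (ENNReal.ofReal_le_ofReal hcost).trans
      (WBary.cost_le_two_mul_phi hlam_pos hlam_sum hP hzy Pbar)
  refine ⟨WBary.isDiscreteProb_mapDomain hQ (hP ⟨0, hN⟩) (hmarg ⟨0, hN⟩), fun x hx => ?_,
    fun Pbar hPbar => (WBary.phi_toMeasure_le hlam_pos htrans).trans (hbound Pbar hPbar),
    ⟨_, htrans, WBary.tuplePlan_nonMassSplitting hQ hmarg hinj, hbound⟩, ?_⟩
  · obtain ⟨q, hq, rfl⟩ := WBary.exists_of_mem_support_mapDomain hx
    exact ⟨q, fun i => WBary.mem_support_of_mapDomain_eq hQ (hmarg i) hq, rfl⟩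
  · have hr := WBary.card_add_le_of_mem_extremePoints hne hzy.1 hs_inj hs_range
    classical
    have hsupp : (Q.mapDomain (WBary.centroid lam)).support.card ≤ Q.support.card :=
      (Finset.card_le_card Finsupp.mapDomain_support).trans Finset.card_image_le
    zify at hr hcard hsupp
    -- `|supp Q| ≤ r * M` and `r ≤ M` for `M = ∑ i, |P i| - N + 1`.
    nlinarith [mul_nonneg (Int.natCast_nonneg r)
      (sub_nonneg.2 (show (r : ℤ) ≤ ∑ i, ((P i).support.card : ℤ) - N + 1 by linarith)),
      Int.natCast_nonneg r]
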